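/- Let $k>0$ be a real number with $k\neq 6$ and $k\neq 1/n$ for every positive integer $n$ (for instance, any integer $k\ge 2$, $k\ne 6$), let $a\in\mathbb C$, and consider the class XII equation $$y'''-2yy''+3y'^2=E\,(6y'-y^2)^2,\qquad E=\frac{4}{36-k^2}. \tag{$*$}$$ (1) There is a function $h$, analytic near $0$, with $h(0)=(k-6)/2$ and $h'(0)=a$, such that $y(x)=x^{-1}h(x^k)$ solves $(*)$ near the origin, for every branch of $x^k$. Its germ at $0$ is unique: if $h_1$ is analytic near $0$, $h_1(0)=(k-6)/2$, $h_1'(0)=a$, and $x^{-1}h_1(x^k)$, with the principal branch of $x^k$, solves $(*)$ in a small disk around $0$ slit along the negative real axis, then $h_1=h$ near $0$. (2) If $k\in\{2,3,4,5\}$, this solution is rational. More precisely, near the origin it equals $y=\frac{k-6}{2}\,\frac{u'}{u}$, where $u\neq0$ is a polynomial satisfying the Cole–Hopf transformed equation $$uu''''-(k-2)u'u'''+\frac{3k(k-2)}{2(k+6)}u''^2=0,$$ and this rational function $y$ solves $(*)$ wherever $u\neq0$. (3) Let $k\in\{2,3,4,5\}$ and let $y$ be the rational solution of (2). For $M=\begin{pmatrix}\alpha&\beta\\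 \gamma&\delta\end{pmatrix}$ put $$(M\cdot y)(x)=\frac{\alpha\delta-\beta\gamma}{(\gamma x+\delta)^2}\,y\!\left(\frac{\alpha x+\beta}{\gamma x+\delta}\right)-\frac{6\gamma}{\gamma x+\delta}.$$ If $\det M\neq0$, then $M\cdot y$ solves $(*)$ at every $x$ with $\gamma x+\delta\ne0$ and $u\big(\frac{\alpha x+\beta}{\gamma x+\delta}\big)\neq 0$. (3a) There are matrices $M_\varepsilon$, with entries analytic in $\varepsilon\in\mathbb C$ near $0$ and $\det M_\varepsilon\ne0$ for small $\varepsilon\ne0$, such that $y(x;\varepsilon)=(M_\varepsilon\cdot y)(x)$ is a one-parameter family of perturbations of $-6/x$ all of whose poles tend to the origin as $\varepsilon\to0$. Here a family of perturbations of $-6/x$ means that $y(x;\varepsilon)$ is jointly analytic near $(x,0)$ for every $x\neq0$, that $y(x;0)=-6/x$, that $y(\cdot;\varepsilon)\to-6/x$ locally uniformly on $\mathbb C\setminus\{0\}$, and that $y(\cdot;\varepsilon)$ is not identically $-6/x$ for small $\varepsilon\neq 0$. (3b) Let $M_\varepsilon$ be any family of matrices, invertible for small $\varepsilon\neq0$,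 such that, as $\varepsilon\to0$, either two distinct poles of $M_\varepsilon\cdot y$ tend to the origin (for every $r>0$, for all small $\varepsilon\ne0$, at least two poles lie in $|x|<r$), or $M_\varepsilon\cdot y\to-6/x$ locally uniformly on some non-empty open set. Then all poles of $M_\varepsilon\cdot y$ in $\mathbb C$, except possibly one, cluster at the origin: for every $r>0$, for all small $\varepsilon\neq0$, at most one pole lies in $|x|\ge r$. -/

import Mathlib

open Filter Topology Polynomial

noncomputable section

namespace ClassXII

/-- `y` is a holomorphic solution, on the open set `U` of the complex plane, of the class XII equation
`y''' - 2 y y'' + 3 y'^2 = E (6 y' - y^2)^2`, where `E = 4 / (36 - k^2)`. -/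
def SolvesOn (k : ℝ) (y : ℂ → ℂ) (U : Set ℂ) : Prop :=
  IsOpen U ∧ DifferentiableOn ℂ y U ∧ ∀ x ∈ U,
    iteratedDeriv 3 y x - 2 * y x * iteratedDeriv 2 y x + 3 * deriv y x ^ 2 =
      4 / (36 - (k : ℂ) ^ 2) * (6 * deriv y x - y x ^ 2) ^ 2

/-- `L` is a continuous (hence holomorphic) branch of the logarithm on the open set `U`. -/
def IsLogBranch (L : ℂ → ℂ) (U : Set ℂ) : Prop :=
  IsOpen U ∧ ContinuousOn L U ∧ ∀ x ∈ U, Complex.exp (L x) = x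

/-- The function `x⁻¹ h(x^k)`, where `x^k = exp (k L x)` is the branch of the power given by `L`. -/
def powerForm (k : ℝ) (h L : ℂ → ℂ) (x : ℂ) : ℂ :=
  x⁻¹ * h (Complex.exp (k * L x))

/-- `x⁻¹ h(x^k)` solves the class XII equation near the origin, for every branch of `x^k`. -/
def SolvesAllBranches (k : ℝ) (h : ℂ → ℂ) : Prop :=
  ∃ r : ℝ, 0 < r ∧ ∀ (U : Set ℂ) (L : ℂ → ℂ), U ⊆ Metric.ball 0 r → IsLogBranch L U →
    SolvesOn k (powerForm k h L) U

/-- `x⁻¹ h(x^k)` solves the class XII equation in a small disk slit along the negative real axis,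
for the principal branch of `x^k`. -/
def SolvesPrincipalBranch (k : ℝ) (h : ℂ → ℂ) : Prop :=
  ∃ r : ℝ, 0 < r ∧
    SolvesOn k (powerForm k h Complex.log) (Metric.ball 0 r ∩ Complex.slitPlane)

/-- The logarithmic derivative `((k - 6) / 2) u' / u` of a polynomial `u`. -/
def coleHopf (k : ℝ) (u : ℂ[X]) (x : ℂ) : ℂ :=
  ((k : ℂ) - 6) / 2 * (u.derivative.eval x / u.eval x)

/-- The polynomial `u` satisfies the Cole-Hopf transformed equation
`u u'''' - (k - 2) u' u''' + (3 k (k - 2) / (2 (k + 6))) u''^2 = 0`. -/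
def SolvesColeHopf (k : ℝ) (u : ℂ[X]) : Prop :=
  u * derivative^[4] u - C ((k : ℂ) - 2) * derivative u * derivative^[3] u
    + C (3 * (k : ℂ) * ((k : ℂ) - 2) / (2 * ((k : ℂ) + 6))) * derivative^[2] u ^ 2 = 0

/-- The action of `M = !![a, b; c, d]` on functions:
`x ↦ (a d - b c) / (c x + d)^2 * y ((a x + b) / (c x + d)) - 6 c / (c x + d)`. -/
def slAction (M : Matrix (Fin 2) (Fin 2) ℂ) (y : ℂ → ℂ) (x : ℂ) : ℂ :=
  M.det / (M 1 0 * x + M 1 1) ^ 2 * y ((M 0 0 * x + M 0 1) / (M 1 0 * x + M 1 1))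
    - 6 * M 1 0 / (M 1 0 * x + M 1 1)

/-- The set of poles of `f` in the complex plane. -/
def poles (f : ℂ → ℂ) : Set ℂ :=
  {x | meromorphicOrderAt f x < 0}

/-- As `ε → 0`, `ε ≠ 0`, all poles of `f ε` tend to the origin. -/
def AllPolesCluster (f : ℂ → ℂ → ℂ) : Prop :=
  ∀ r : ℝ, 0 < r → ∀ᶠ ε in 𝓝[≠] (0 : ℂ), poles (f ε) ⊆ Metric.ball 0 r

/-- As `ε → 0`, `ε ≠ 0`, all poles of `f ε`, with the possible exception of one, tend to the
origin. -/
def AllPolesButOneCluster (f : ℂ → ℂ → ℂ) : Prop :=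
  ∀ r : ℝ, 0 < r → ∀ᶠ ε in 𝓝[≠] (0 : ℂ), (poles (f ε) \ Metric.ball 0 r).encard ≤ 1

/-- As `ε → 0`, `ε ≠ 0`, at least two distinct poles of `f ε` tend to the origin. -/
def TwoPolesCluster (f : ℂ → ℂ → ℂ) : Prop :=
  ∀ r : ℝ, 0 < r → ∀ᶠ ε in 𝓝[≠] (0 : ℂ), 2 ≤ (poles (f ε) ∩ Metric.ball 0 r).encard

/-- `f ε`, `ε → 0`, is an analytic one-parameter family of perturbations of `-6 / x`:
it is jointly analytic at `ε = 0` and `x ≠ 0`, it equals `-6 / x` for `ε = 0`, it tends to `-6 / x`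
locally uniformly on the punctured plane, and for small `ε ≠ 0` it differs from `-6 / x`. -/
def IsPerturbationFamily (f : ℂ → ℂ → ℂ) : Prop :=
  (∀ x : ℂ, x ≠ 0 → AnalyticAt ℂ (fun p : ℂ × ℂ => f p.2 p.1) (x, 0)) ∧
  (∀ x : ℂ, x ≠ 0 → f 0 x = -6 / x) ∧
  TendstoLocallyUniformlyOn f (fun x => -6 / x) (𝓝[≠] (0 : ℂ)) {x | x ≠ 0} ∧
  ∀ᶠ ε in 𝓝[≠] (0 : ℂ), ¬ (f ε =ᶠ[𝓝[≠] (0 : ℂ)] fun x => -6 / x)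

end ClassXII

end

/-! Write y = g/x and θ = x d/dx. After multiplication by x^4 the equation becomes a polynomial
identity in g, θg, θ²g, θ³g (`eulerForm`). For g = h(s), s = x^k, the operator θ acts as k s d/ds,
so the branch of x^k disappears. The constant c = (k-6)/2 is a solution, and the linearisation there
factors as (θ-k)(θ²-1). On s^n it is multiplication by k(n-1)(n²k²-1), which vanishes at n = 1,
where a is free, and for n ≥ 2 only if k = 1/n. The remaining terms are at least quadratic, so every
coefficient from n = 2 on is determined by the earlier ones. This gives existence and uniqueness of
the formal solution. It converges because the cubic growth of the linear factor beats the two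
derivatives in the nonlinear part.

Putting y = c u'/u cancels all terms except the Cole–Hopf equation. That equation has explicit
polynomial solutions u = x q(x^k) for k = 2, 3, 4, 5. Since q'(0) is arbitrary, uniqueness in (1)
identifies c u'/u with the solution for any a.

The equation is covariant under the Möbius action, and since dc = -6 with d = 12/(6-k), the
transformed solution is c times the logarithmic derivative of the degree d transform of u
(`slAction_eq_log_deriv`). For (3a) one substitutes x₀ - ε/x with u(x₀) ≠ 0. For (3b), the poles lie
over the finite set of roots of u and infinity. If two poles collapse at the origin while two others
stay away, a cross-ratio is unbounded, although it takes only finitely many values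
(`dist_bound_of_poles`). If instead the family tends to -6/x, the normalised transforms of u tend to
a multiple of x^d, whose only zero is 0 (`eventually_eval_ne_zero_of_tendsto`). -/

noncomputable section

namespace ClassXII

/-! ### Formal power series solutions in s = x^k -/

/-- The class XII equation for `x⁻¹ g`, in terms of `g` and its iterated Euler derivatives. -/
def eulerForm {A : Type*} [CommRing A] (e g₀ g₁ g₂ g₃ : A) : A :=
  (g₃ - 6 * g₂ + 11 * g₁ - 6 * g₀) - 2 * g₀ * (g₂ - 3 * g₁ + 2 * g₀) + 3 * (g₁ - g₀) ^ 2
    - e * (6 * (g₁ - g₀) - g₀ ^ 2) ^ 2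

/-- The nonlinear part of `eulerForm` at the constant solution `c`. -/
def nonlin {A : Type*} [CommRing A] (e c f₀ f₁ f₂ : A) : A :=
  2 * (f₀ * (f₂ - 3 * f₁ + 2 * f₀)) - 3 * ((f₁ - f₀) * (f₁ - f₀))
    + e * ((6 * (f₁ - f₀) - 2 * c * f₀ - f₀ * f₀) * (6 * (f₁ - f₀) - 2 * c * f₀ - f₀ * f₀))
    - 2 * (f₀ * f₀)

/-- The constant term of the expansion is -c(6+c)(1 + ec(6+c)), which `he` kills. With κ = 6+2c the
linear part is (θ-κ)(θ²-1). -/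
theorem eulerForm_const_add {A : Type*} [CommRing A] {e c κ : A} (he : e * c * (6 + c) = -1)
    (hκ : κ = 6 + 2 * c) (f₀ f₁ f₂ f₃ : A) :
    eulerForm e (c + f₀) f₁ f₂ f₃ = f₃ - κ * f₂ - f₁ + κ * f₀ - nonlin e c f₀ f₁ f₂ := by
  subst hκ
  unfold eulerForm nonlin
  linear_combination (-(c * (6 + c)) + 2 * (6 * (f₁ - f₀) - 2 * c * f₀ - f₀ * f₀)) * he

/-- The operator `κ X d/dX` on formal power series. -/
def euler (κ : ℂ) (F : PowerSeries ℂ) : PowerSeries ℂ :=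
  PowerSeries.mk fun n => κ * n * PowerSeries.coeff n F

theorem coeff_euler (κ : ℂ) (F : PowerSeries ℂ) (n : ℕ) :
    PowerSeries.coeff n (euler κ F) = κ * n * PowerSeries.coeff n F := by
  simp [euler]

theorem X_pow_dvd_euler_sub {κ : ℂ} {F G : PowerSeries ℂ} {n : ℕ}
    (h : PowerSeries.X ^ n ∣ F - G) : PowerSeries.X ^ n ∣ euler κ F - euler κ G := by
  rw [PowerSeries.X_pow_dvd_iff] at h ⊢
  intro m hm
  have := h m hm
  rw [map_sub] at this ⊢
  rw [coeff_euler, coeff_euler, ← mul_sub, this, mul_zero]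

theorem X_dvd_euler (κ : ℂ) (F : PowerSeries ℂ) : PowerSeries.X ∣ euler κ F := by
  rw [PowerSeries.X_dvd_iff, ← PowerSeries.coeff_zero_eq_constantCoeff_apply, coeff_euler]
  simp

theorem pow_succ_dvd_mul_sub_mul {A : Type*} [CommRing A] {x a b a' b' : A} {n : ℕ}
    (hb : x ∣ b) (ha' : x ∣ a') (haa : x ^ n ∣ a - a') (hbb : x ^ n ∣ b - b') :
    x ^ (n + 1) ∣ a * b - a' * b' := by
  have : a * b - a' * b' = (a - a') * b + (b - b') * a' := by ring
  rw [this, pow_succ]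
  exact dvd_add (mul_dvd_mul haa hb) (mul_dvd_mul hbb ha')

/-- Each term of `nonlin` is a product of two factors vanishing at the origin, so agreement to order
n improves by one. This contraction drives both existence and uniqueness. -/
theorem pow_succ_dvd_nonlin_sub {A : Type*} [CommRing A] {x e c f₀ f₁ f₂ g₀ g₁ g₂ : A} {n : ℕ}
    (hf₀ : x ∣ f₀) (hf₁ : x ∣ f₁) (hf₂ : x ∣ f₂) (hg₀ : x ∣ g₀) (hg₁ : x ∣ g₁)
    (h₀ : x ^ n ∣ f₀ - g₀) (h₁ : x ^ n ∣ f₁ - g₁) (h₂ : x ^ n ∣ f₂ - g₂) :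
    x ^ (n + 1) ∣ nonlin e c f₀ f₁ f₂ - nonlin e c g₀ g₁ g₂ := by
  have hff : x ∣ f₀ * f₀ := hf₀.mul_right _
  have hgg : x ∣ g₀ * g₀ := hg₀.mul_right _
  have hsq := pow_succ_dvd_mul_sub_mul hf₀ hg₀ h₀ h₀
  have hsq' : x ^ n ∣ f₀ * f₀ - g₀ * g₀ := (pow_dvd_pow x n.le_succ).trans hsq
  have k₁ : x ^ n ∣ (f₁ - f₀) - (g₁ - g₀) := by
    convert dvd_sub h₁ h₀ using 1; ring
  have k₂ : x ^ n ∣ (f₂ - 3 * f₁ + 2 * f₀) - (g₂ - 3 * g₁ + 2 * g₀) := by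
    convert dvd_add (dvd_sub h₂ (h₁.mul_left 3)) (h₀.mul_left 2) using 1; ring
  have k₃ : x ^ n ∣ (6 * (f₁ - f₀) - 2 * c * f₀ - f₀ * f₀)
      - (6 * (g₁ - g₀) - 2 * c * g₀ - g₀ * g₀) := by
    convert dvd_sub (dvd_sub (k₁.mul_left 6) (h₀.mul_left (2 * c))) hsq' using 1; ring
  have d₁ : x ∣ f₁ - f₀ := dvd_sub hf₁ hf₀
  have d₁' : x ∣ g₁ - g₀ := dvd_sub hg₁ hg₀
  have d₂ : x ∣ f₂ - 3 * f₁ + 2 * f₀ :=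
    dvd_add (dvd_sub hf₂ (hf₁.mul_left 3)) (hf₀.mul_left 2)
  have d₃ : x ∣ 6 * (f₁ - f₀) - 2 * c * f₀ - f₀ * f₀ :=
    dvd_sub (dvd_sub (d₁.mul_left 6) (hf₀.mul_left _)) hff
  have d₃' : x ∣ 6 * (g₁ - g₀) - 2 * c * g₀ - g₀ * g₀ :=
    dvd_sub (dvd_sub (d₁'.mul_left 6) (hg₀.mul_left _)) hgg
  have := dvd_sub (dvd_add (dvd_sub
    ((pow_succ_dvd_mul_sub_mul d₂ hg₀ h₀ k₂).mul_left 2)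
    ((pow_succ_dvd_mul_sub_mul d₁ d₁' k₁ k₁).mul_left 3))
    ((pow_succ_dvd_mul_sub_mul d₃ d₃' k₃ k₃).mul_left e)) (hsq.mul_left 2)
  convert this using 1
  unfold nonlin
  ring

/-- The nonlinear part as an operator on power series. -/
def nonlinSeries (e c κ : ℂ) (f : PowerSeries ℂ) : PowerSeries ℂ :=
  nonlin (PowerSeries.C e) (PowerSeries.C c) f (euler κ f) (euler κ (euler κ f))

theorem X_pow_succ_dvd_nonlinSeries_sub {e c κ : ℂ} {f g : PowerSeries ℂ} {n : ℕ}
    (hf : PowerSeries.X ∣ f) (hg : PowerSeries.X ∣ g) (h : PowerSeries.X ^ n ∣ f - g) :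
    PowerSeries.X ^ (n + 1) ∣ nonlinSeries e c κ f - nonlinSeries e c κ g :=
  pow_succ_dvd_nonlin_sub hf (X_dvd_euler _ _) (X_dvd_euler _ _) hg (X_dvd_euler _ _) h
    (X_pow_dvd_euler_sub h) (X_pow_dvd_euler_sub (X_pow_dvd_euler_sub h))

/-- The indicial polynomial of the linearisation, at the exponent `n κ`. -/
def indicial (κ : ℂ) (n : ℕ) : ℂ := (n - 1) * κ * (n ^ 2 * κ ^ 2 - 1)

/-- Coefficientwise form of the equation for a power series `f` without constant term. -/
def IsFormalSolution (e c κ : ℂ) (f : PowerSeries ℂ) : Prop :=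
  ∀ n, indicial κ n * PowerSeries.coeff n f = PowerSeries.coeff n (nonlinSeries e c κ f)

theorem eulerForm_eq_zero_iff {e c κ : ℂ} (he : e * c * (6 + c) = -1)
    (hκ : κ = 6 + 2 * c) (f : PowerSeries ℂ) :
    eulerForm (PowerSeries.C e) (PowerSeries.C c + f) (euler κ f) (euler κ (euler κ f))
      (euler κ (euler κ (euler κ f))) = 0 ↔ IsFormalSolution e c κ f := by
  have he' : PowerSeries.C e * PowerSeries.C c * (6 + PowerSeries.C c) = -1 := by
    have := congrArg (PowerSeries.C (R := ℂ)) he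
    simpa [map_ofNat (PowerSeries.C (R := ℂ)) 6] using this
  have hκ' : PowerSeries.C κ = 6 + 2 * PowerSeries.C c := by
    have := congrArg (PowerSeries.C (R := ℂ)) hκ
    simpa [map_ofNat (PowerSeries.C (R := ℂ)) 6, map_ofNat (PowerSeries.C (R := ℂ)) 2] using this
  rw [eulerForm_const_add he' hκ', sub_eq_zero, PowerSeries.ext_iff]
  refine forall_congr' fun n => ?_
  rw [← nonlinSeries]
  simp only [map_add, map_sub, PowerSeries.coeff_C_mul, coeff_euler, indicial]
  rw [iff_iff_eq]
  congr 1
  ring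

/-- Agreement below order n+2 makes the nonlinear parts agree in degree n+2, and dividing by the
nonzero indicial factor gives one more coefficient. The free coefficient sits at n = 1, so the
induction starts at order 2. -/
theorem IsFormalSolution.eq {e c κ : ℂ} (hP : ∀ n, 2 ≤ n → indicial κ n ≠ 0)
    {f g : PowerSeries ℂ} (hf : IsFormalSolution e c κ f) (hg : IsFormalSolution e c κ g)
    (hf₀ : PowerSeries.coeff 0 f = 0) (hg₀ : PowerSeries.coeff 0 g = 0)
    (h₁ : PowerSeries.coeff 1 f = PowerSeries.coeff 1 g) : f = g := by
  have hXf : PowerSeries.X ∣ f := by rw [PowerSeries.X_dvd_iff]; simpa using hf₀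
  have hXg : PowerSeries.X ∣ g := by rw [PowerSeries.X_dvd_iff]; simpa using hg₀
  have key : ∀ n, PowerSeries.X ^ (n + 2) ∣ f - g := by
    intro n
    induction n with
    | zero =>
      rw [PowerSeries.X_pow_dvd_iff]
      intro m hm
      interval_cases m
      · rw [map_sub, hf₀, hg₀, sub_zero]
      · rw [map_sub, h₁, sub_self]
    | succ n ih =>
      have := X_pow_succ_dvd_nonlinSeries_sub (e := e) (c := c) (κ := κ) hXf hXg ih
      rw [PowerSeries.X_pow_dvd_iff] at this ih ⊢
      intro m hm
      rcases Nat.lt_or_ge m (n + 2) with hlt | hge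
      · exact ih m hlt
      · have h := this m hm
        rw [map_sub, ← hf m, ← hg m, ← mul_sub, ← map_sub] at h
        exact (mul_eq_zero.mp h).resolve_left (hP m (by omega))
  rw [← sub_eq_zero, PowerSeries.ext_iff]
  intro n
  exact PowerSeries.X_pow_dvd_iff.mp (key n) n (by omega)

/-- The coefficients of the formal solution with linear coefficient `a`. -/
def solCoeff (e c κ a : ℂ) (n : ℕ) : ℂ :=
  if n = 0 then 0 else if n = 1 then a else
    PowerSeries.coeff n (nonlinSeries e c κ
      (PowerSeries.mk fun i => if _ : i < n then solCoeff e c κ a i else 0)) / indicial κ n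
termination_by n

/-- The truncation of a sequence of coefficients to a power series. -/
def truncSeries (b : ℕ → ℂ) (n : ℕ) : PowerSeries ℂ :=
  PowerSeries.mk fun i => if i < n then b i else 0

theorem coeff_truncSeries (b : ℕ → ℂ) (n i : ℕ) :
    PowerSeries.coeff i (truncSeries b n) = if i < n then b i else 0 := by
  simp [truncSeries]

theorem X_dvd_truncSeries {b : ℕ → ℂ} (hb : b 0 = 0) (n : ℕ) :
    PowerSeries.X ∣ truncSeries b n := by
  rw [PowerSeries.X_dvd_iff, ← PowerSeries.coeff_zero_eq_constantCoeff_apply, coeff_truncSeries, hb]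
  simp

theorem X_pow_dvd_mk_sub_truncSeries (b : ℕ → ℂ) (n : ℕ) :
    PowerSeries.X ^ n ∣ PowerSeries.mk b - truncSeries b n := by
  rw [PowerSeries.X_pow_dvd_iff]
  intro m hm
  rw [map_sub, coeff_truncSeries, if_pos hm, PowerSeries.coeff_mk, sub_self]

theorem solCoeff_zero (e c κ a : ℂ) : solCoeff e c κ a 0 = 0 := by
  rw [solCoeff]; simp

theorem solCoeff_one (e c κ a : ℂ) : solCoeff e c κ a 1 = a := by
  rw [solCoeff]; simp

/-- Coefficients up to n of the nonlinear part involve only those of index below n, so the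
truncation in the recursion `solCoeff` loses nothing. -/
theorem coeff_nonlinSeries_mk {e c κ : ℂ} {b : ℕ → ℂ} (hb : b 0 = 0) {i n : ℕ} (h : i ≤ n) :
    PowerSeries.coeff i (nonlinSeries e c κ (PowerSeries.mk b)) =
      PowerSeries.coeff i (nonlinSeries e c κ (truncSeries b n)) := by
  have hX : PowerSeries.X ∣ PowerSeries.mk b := by
    rw [PowerSeries.X_dvd_iff, ← PowerSeries.coeff_zero_eq_constantCoeff_apply]; simpa using hb
  have := X_pow_succ_dvd_nonlinSeries_sub (e := e) (c := c) (κ := κ) hX (X_dvd_truncSeries hb n)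
    (X_pow_dvd_mk_sub_truncSeries b n)
  rw [PowerSeries.X_pow_dvd_iff] at this
  have := this i (by omega)
  rwa [map_sub, sub_eq_zero] at this

theorem isFormalSolution_solCoeff {e c κ : ℂ} (hP : ∀ n, 2 ≤ n → indicial κ n ≠ 0) (a : ℂ) :
    IsFormalSolution e c κ (PowerSeries.mk (solCoeff e c κ a)) := by
  intro n
  rw [coeff_nonlinSeries_mk (solCoeff_zero e c κ a) le_rfl, PowerSeries.coeff_mk]
  -- Degrees 0 and 1 are not given by the recursion. There the nonlinear part vanishes, and so do
  -- the zeroth coefficient and the indicial factor at 1.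
  have hz : truncSeries (solCoeff e c κ a) 1 = 0 := by
    ext i
    rw [coeff_truncSeries]
    rcases Nat.eq_zero_or_pos i with rfl | hi
    · simp [solCoeff_zero]
    · rw [if_neg (by omega)]; simp
  have hz' : nonlinSeries e c κ 0 = 0 := by
    have : euler κ 0 = 0 := by ext i; simp [coeff_euler]
    simp [nonlinSeries, nonlin, this]
  rcases Nat.lt_or_ge n 2 with hn | hn
  · interval_cases n
    · rw [← coeff_nonlinSeries_mk (solCoeff_zero e c κ a) le_rfl,
        coeff_nonlinSeries_mk (solCoeff_zero e c κ a) zero_le_one, hz, hz', solCoeff_zero]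
      simp
    · rw [hz, hz']
      simp [indicial]
  · rw [solCoeff, if_neg (by omega), if_neg (by omega), mul_div_cancel₀ _ (hP n hn)]
    simp [truncSeries]

/-! ### Convergence of the formal solution -/

/-- The truncated weighted `ℓ¹` norm of a power series. -/
def truncNorm (r : ℝ) (N : ℕ) (F : PowerSeries ℂ) : ℝ :=
  ∑ n ∈ Finset.range (N + 1), ‖PowerSeries.coeff n F‖ * r ^ n

theorem truncNorm_nonneg {r : ℝ} (hr : 0 ≤ r) (N : ℕ) (F : PowerSeries ℂ) :
    0 ≤ truncNorm r N F :=
  Finset.sum_nonneg fun _ _ => by positivity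

theorem truncNorm_add {r : ℝ} (hr : 0 ≤ r) (N : ℕ) (F G : PowerSeries ℂ) :
    truncNorm r N (F + G) ≤ truncNorm r N F + truncNorm r N G := by
  unfold truncNorm
  rw [← Finset.sum_add_distrib]
  refine Finset.sum_le_sum fun n _ => ?_
  rw [← add_mul, map_add]
  gcongr
  exact norm_add_le _ _

theorem truncNorm_sub {r : ℝ} (hr : 0 ≤ r) (N : ℕ) (F G : PowerSeries ℂ) :
    truncNorm r N (F - G) ≤ truncNorm r N F + truncNorm r N G := by
  unfold truncNorm
  rw [← Finset.sum_add_distrib]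
  refine Finset.sum_le_sum fun n _ => ?_
  rw [← add_mul, map_sub]
  gcongr
  exact norm_sub_le _ _

theorem truncNorm_C_mul (r : ℝ) (N : ℕ) (x : ℂ) (F : PowerSeries ℂ) :
    truncNorm r N (PowerSeries.C x * F) = ‖x‖ * truncNorm r N F := by
  unfold truncNorm
  rw [Finset.mul_sum]
  refine Finset.sum_congr rfl fun n _ => ?_
  rw [PowerSeries.coeff_C_mul, norm_mul, mul_assoc]

theorem truncNorm_ofNat_mul (r : ℝ) (N : ℕ) (n : ℕ) [n.AtLeastTwo] (F : PowerSeries ℂ) :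
    truncNorm r N (OfNat.ofNat n * F) = OfNat.ofNat n * truncNorm r N F := by
  rw [← map_ofNat (PowerSeries.C (R := ℂ)) n, truncNorm_C_mul]
  simp

theorem truncNorm_mul {r : ℝ} (hr : 0 ≤ r) (N : ℕ) (F G : PowerSeries ℂ) :
    truncNorm r N (F * G) ≤ truncNorm r N F * truncNorm r N G := by
  unfold truncNorm
  rw [Finset.sum_mul_sum, ← Finset.sum_product']
  calc _ ≤ ∑ n ∈ Finset.range (N + 1), ∑ p ∈ Finset.HasAntidiagonal.antidiagonal n,
        (‖PowerSeries.coeff p.1 F‖ * r ^ p.1) * (‖PowerSeries.coeff p.2 G‖ * r ^ p.2) := by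
        refine Finset.sum_le_sum fun n _ => ?_
        rw [PowerSeries.coeff_mul]
        calc _ ≤ (∑ p ∈ Finset.HasAntidiagonal.antidiagonal n,
              ‖PowerSeries.coeff p.1 F * PowerSeries.coeff p.2 G‖) * r ^ n := by
              gcongr; exact norm_sum_le _ _
          _ = _ := by
              rw [Finset.sum_mul]
              refine Finset.sum_congr rfl fun p hp => ?_
              rw [← Finset.HasAntidiagonal.mem_antidiagonal.mp hp, norm_mul, pow_add]
              ring
    _ = ∑ n ∈ Finset.range (N + 1),
        ∑ p ∈ (Finset.range (N + 1) ×ˢ Finset.range (N + 1)).filter (fun p => p.1 + p.2 = n),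
        (‖PowerSeries.coeff p.1 F‖ * r ^ p.1) * (‖PowerSeries.coeff p.2 G‖ * r ^ p.2) := by
        refine Finset.sum_congr rfl fun n hn => Finset.sum_congr ?_ fun _ _ => rfl
        ext p
        simp only [Finset.HasAntidiagonal.mem_antidiagonal, Finset.mem_filter, Finset.mem_product,
          Finset.mem_range] at hn ⊢
        omega
    _ ≤ _ := by
        rw [Finset.sum_fiberwise_eq_sum_filter]
        exact Finset.sum_le_sum_of_subset_of_nonneg (Finset.filter_subset _ _)
          fun _ _ _ => by positivity

/-- The norm is submultiplicative and every term is at least quadratic. The bound δ ≤ 1 absorbs the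
cubic and quartic terms into δ². -/
theorem truncNorm_nonlinSeries_le {e c κ : ℂ} {r δ : ℝ} (hr : 0 ≤ r) (hδ : 0 ≤ δ) (hδ₁ : δ ≤ 1)
    {N : ℕ} {f : PowerSeries ℂ} (h₀ : truncNorm r N f ≤ δ)
    (h₁ : truncNorm r N (euler κ f) ≤ ‖κ‖ * δ)
    (h₂ : truncNorm r N (euler κ (euler κ f)) ≤ ‖κ‖ ^ 2 * δ) :
    truncNorm r N (nonlinSeries e c κ f) ≤
      (2 * (‖κ‖ ^ 2 + 3 * ‖κ‖ + 2) + 3 * (‖κ‖ + 1) ^ 2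
        + ‖e‖ * (6 * (‖κ‖ + 1) + 2 * ‖c‖ + 1) ^ 2 + 2) * δ ^ 2 := by
  have hn := truncNorm_nonneg (r := r) hr N
  have hmul : ∀ {F G : PowerSeries ℂ} {x y : ℝ}, truncNorm r N F ≤ x → truncNorm r N G ≤ y →
      truncNorm r N (F * G) ≤ x * y := fun {F G x y} hF hG =>
    (truncNorm_mul hr N F G).trans (mul_le_mul hF hG (hn _) ((hn _).trans hF))
  have hadd : ∀ {F G : PowerSeries ℂ} {x y : ℝ}, truncNorm r N F ≤ x → truncNorm r N G ≤ y →
      truncNorm r N (F + G) ≤ x + y := fun {F G x y} hF hG =>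
    (truncNorm_add hr N F G).trans (add_le_add hF hG)
  have hsub : ∀ {F G : PowerSeries ℂ} {x y : ℝ}, truncNorm r N F ≤ x → truncNorm r N G ≤ y →
      truncNorm r N (F - G) ≤ x + y := fun {F G x y} hF hG =>
    (truncNorm_sub hr N F G).trans (add_le_add hF hG)
  have hC : ∀ (z : ℂ) {F : PowerSeries ℂ} {x : ℝ}, truncNorm r N F ≤ x →
      truncNorm r N (PowerSeries.C z * F) ≤ ‖z‖ * x := fun z {F x} hF => by
    rw [truncNorm_C_mul]; gcongr
  have hN : ∀ (n : ℕ) [n.AtLeastTwo] {F : PowerSeries ℂ} {x : ℝ}, truncNorm r N F ≤ x →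
      truncNorm r N (OfNat.ofNat n * F) ≤ OfNat.ofNat n * x := fun n _ {F x} hF => by
    rw [truncNorm_ofNat_mul]
    exact mul_le_mul_of_nonneg_left hF (Nat.cast_nonneg _)
  unfold nonlinSeries nonlin
  set f₁ := euler κ f
  set f₂ := euler κ (euler κ f)
  have k₁ := hsub h₁ h₀
  have k₂ := hadd (hsub h₂ (hN 3 h₁)) (hN 2 h₀)
  have k₃ := hsub (hsub (hN 6 k₁) (hN 2 (hC c h₀))) (hmul h₀ h₀)
  rw [← mul_assoc] at k₃
  have k₃' := k₃.trans (show _ ≤ (6 * (‖κ‖ + 1) + 2 * ‖c‖ + 1) * δ by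
    have : δ * δ ≤ 1 * δ := by gcongr
    linarith)
  refine (hsub (hadd (hsub (hN 2 (hmul h₀ k₂)) (hN 3 (hmul k₁ k₁)))
    (hC e (hmul k₃' k₃'))) (hN 2 (hmul h₀ h₀))).trans (le_of_eq ?_)
  ring

/-- The weight n² is what is needed to control f, θf and θ²f together. Once nk ≥ 2, n²k²-1 ≥ n²k²/2
gives the constant 2/k³. The finitely many smaller n are covered by the sum of their ratios. -/
theorem exists_sq_le_indicial {k : ℝ} (hk : 0 < k)
    (hP : ∀ n, 2 ≤ n → indicial (k : ℂ) n ≠ 0) :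
    ∃ K : ℝ, 0 ≤ K ∧ ∀ n : ℕ, 2 ≤ n → (n : ℝ) ^ 2 ≤ K * ‖indicial (k : ℂ) n‖ := by
  obtain ⟨n₀, hn₀⟩ := exists_nat_ge (2 / k)
  have hs : 0 ≤ ∑ i ∈ Finset.range n₀, (i : ℝ) ^ 2 / ‖indicial (k : ℂ) i‖ :=
    Finset.sum_nonneg fun _ _ => by positivity
  refine ⟨2 / k ^ 3 + ∑ i ∈ Finset.range n₀, (i : ℝ) ^ 2 / ‖indicial (k : ℂ) i‖,
    by positivity, fun n hn => ?_⟩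
  have hpos : 0 < ‖indicial (k : ℂ) n‖ := norm_pos_iff.mpr (hP n hn)
  rcases Nat.lt_or_ge n n₀ with h | h
  · rw [← div_le_iff₀ hpos]
    have : (n : ℝ) ^ 2 / ‖indicial (k : ℂ) n‖ ≤
        ∑ i ∈ Finset.range n₀, (i : ℝ) ^ 2 / ‖indicial (k : ℂ) i‖ :=
      Finset.single_le_sum (f := fun i : ℕ => (i : ℝ) ^ 2 / ‖indicial (k : ℂ) i‖)
        (fun _ _ => by positivity) (Finset.mem_range.mpr h)
    have : 0 ≤ 2 / k ^ 3 := by positivity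
    linarith
  · have h2 : (2 : ℝ) ≤ n := by exact_mod_cast hn
    have hnk : 2 ≤ n * k := by
      rw [← div_le_iff₀ hk]
      exact hn₀.trans (by exact_mod_cast h)
    have e1 : ‖indicial (k : ℂ) n‖ = (n - 1) * k * (n ^ 2 * k ^ 2 - 1) := by
      have : indicial (k : ℂ) n = (((n - 1) * k * (n ^ 2 * k ^ 2 - 1) : ℝ) : ℂ) := by
        simp [indicial]
      rw [this, Complex.norm_real, Real.norm_of_nonneg]
      have : 0 ≤ (n : ℝ) ^ 2 * k ^ 2 - 1 := by nlinarith
      have : (0 : ℝ) ≤ n - 1 := by linarith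
      positivity
    have e2 : (n : ℝ) ^ 2 ≤ 2 / k ^ 3 * ‖indicial (k : ℂ) n‖ := by
      rw [e1, div_mul_eq_mul_div, le_div_iff₀ (by positivity)]
      have h3 : (n : ℝ) ^ 2 * k ^ 2 ≤ 2 * (n ^ 2 * k ^ 2 - 1) := by nlinarith
      have h4 : k * (n ^ 2 * k ^ 2) ≤ k * (2 * (n ^ 2 * k ^ 2 - 1)) := by gcongr
      have h5 : 0 ≤ k * (2 * ((n : ℝ) ^ 2 * k ^ 2 - 1)) := le_trans (by positivity) h4
      nlinarith
    have := mul_nonneg hs hpos.le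
    rw [add_mul]
    linarith

theorem truncNorm_truncSeries_le {κ : ℂ} {r : ℝ} (hr : 0 ≤ r) {b : ℕ → ℂ} (hb : b 0 = 0)
    (N n : ℕ) {T : PowerSeries ℂ} {x : ℝ} (j : ℕ) (hj : j ≤ 2)
    (hT : ∀ i, PowerSeries.coeff i T = (κ * i) ^ j * PowerSeries.coeff i (truncSeries b n))
    (hx : ∑ i ∈ Finset.range n, (i : ℝ) ^ 2 * ‖b i‖ * r ^ i ≤ x) :
    truncNorm r N T ≤ ‖κ‖ ^ j * x := by
  calc truncNorm r N T ≤ ∑ i ∈ Finset.range (N + 1),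
        if i < n then ‖κ‖ ^ j * ((i : ℝ) ^ 2 * ‖b i‖ * r ^ i) else 0 := by
        refine Finset.sum_le_sum fun i _ => ?_
        rw [hT, coeff_truncSeries]
        split_ifs with h
        · rcases Nat.eq_zero_or_pos i with rfl | hi
          · simp [hb]
          · have h1 : (1 : ℝ) ≤ i := by exact_mod_cast hi
            have h2 : (i : ℝ) ^ j ≤ (i : ℝ) ^ 2 := pow_le_pow_right₀ h1 hj
            rw [norm_mul, norm_pow, norm_mul, Complex.norm_natCast, mul_pow]
            calc _ = ‖κ‖ ^ j * ((i : ℝ) ^ j * ‖b i‖ * r ^ i) := by ring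
              _ ≤ _ := by gcongr
        · simp
    _ = ∑ i ∈ (Finset.range (N + 1)).filter (· < n),
          ‖κ‖ ^ j * ((i : ℝ) ^ 2 * ‖b i‖ * r ^ i) := by rw [Finset.sum_filter]
    _ ≤ ∑ i ∈ Finset.range n, ‖κ‖ ^ j * ((i : ℝ) ^ 2 * ‖b i‖ * r ^ i) := by
        refine Finset.sum_le_sum_of_subset_of_nonneg (fun i hi => ?_) fun _ _ _ => by positivity
        simpa using (Finset.mem_filter.mp hi).2
    _ ≤ _ := by rw [← Finset.mul_sum]; gcongr

theorem exists_summable_solCoeff {k : ℝ} (hk : 0 < k) (e c a : ℂ)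
    (hP : ∀ n, 2 ≤ n → indicial (k : ℂ) n ≠ 0) :
    ∃ r : ℝ, 0 < r ∧ Summable fun n => ‖solCoeff e c k a n‖ * r ^ n := by
  obtain ⟨K, hK₀, hK⟩ := exists_sq_le_indicial hk hP
  set b := solCoeff e c k a with hb
  set Q : ℝ := 2 * (‖(k : ℂ)‖ ^ 2 + 3 * ‖(k : ℂ)‖ + 2) + 3 * (‖(k : ℂ)‖ + 1) ^ 2
        + ‖e‖ * (6 * (‖(k : ℂ)‖ + 1) + 2 * ‖c‖ + 1) ^ 2 + 2 with hQ
  have hQ₀ : 0 ≤ Q := by positivity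
  -- Chosen so that KQδ ≤ 1/2. Then r makes the linear term ‖a‖r at most δ/2, and the two halves
  -- close the bootstrap below.
  set δ : ℝ := 1 / (2 * K * Q + 1) with hδ
  have hδ₀ : 0 < δ := by positivity
  have hδ₁ : δ ≤ 1 := by
    rw [hδ, div_le_one (by positivity)]
    nlinarith [mul_nonneg hK₀ hQ₀]
  have hδK : K * (Q * δ ^ 2) ≤ δ / 2 := by
    have h1 : (2 * K * Q + 1) * δ = 1 := by rw [hδ]; field_simp
    nlinarith
  set r : ℝ := δ / (2 * (‖a‖ + 1)) with hr
  have hr₀ : 0 < r := by positivity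
  have hra : ‖a‖ * r ≤ δ / 2 := by
    rw [hr, ← mul_div_assoc, div_le_div_iff₀ (by positivity) (by positivity)]
    nlinarith [norm_nonneg a]
  have hb₀ : b 0 = 0 := solCoeff_zero _ _ _ _
  -- Bootstrap: if the weighted partial sum up to N is at most δ, the next one is at most ‖a‖r +
  -- KQδ² ≤ δ, since the new coefficient depends only on the truncation.
  have hS : ∀ n, ∑ i ∈ Finset.range n, (i : ℝ) ^ 2 * ‖b i‖ * r ^ i ≤ δ := by
    intro n
    induction n with
    | zero => simpa using hδ₀.le
    | succ N ih =>
      have hG := truncNorm_nonlinSeries_le (e := e) (c := c) (κ := (k : ℂ)) hr₀.le hδ₀.le hδ₁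
        (N := N) (f := truncSeries b N)
        (by simpa using truncNorm_truncSeries_le (κ := (k : ℂ)) hr₀.le hb₀ N N 0 (by norm_num)
              (by simp) ih)
        (by simpa using truncNorm_truncSeries_le (κ := (k : ℂ)) hr₀.le hb₀ N N 1 (by norm_num)
              (fun i => by rw [coeff_euler, pow_one]) ih)
        (truncNorm_truncSeries_le (κ := (k : ℂ)) hr₀.le hb₀ N N 2 le_rfl
              (fun i => by rw [coeff_euler, coeff_euler]; ring) ih)
      rw [← hQ] at hG
      calc ∑ i ∈ Finset.range (N + 1), (i : ℝ) ^ 2 * ‖b i‖ * r ^ i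
          ≤ ∑ i ∈ Finset.range (N + 1), ((if i = 1 then ‖a‖ * r else 0) +
              K * (‖PowerSeries.coeff i (nonlinSeries e c k (truncSeries b N))‖ * r ^ i)) := by
            refine Finset.sum_le_sum fun i hi => ?_
            have hnn : 0 ≤ K * (‖PowerSeries.coeff i (nonlinSeries e c k (truncSeries b N))‖
              * r ^ i) := by positivity
            rcases Nat.lt_or_ge i 2 with h2 | h2
            · interval_cases i
              · simpa [hb₀] using hnn
              · have : b 1 = a := solCoeff_one _ _ _ _
                simpa [this] using hnn
            · rw [if_neg (by omega), zero_add]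
              have hform := isFormalSolution_solCoeff (e := e) (c := c) hP a i
              rw [coeff_nonlinSeries_mk (solCoeff_zero e c k a)
                (Nat.lt_succ_iff.mp (Finset.mem_range.mp hi)), PowerSeries.coeff_mk] at hform
              rw [← hform, norm_mul, ← hb]
              calc _ ≤ K * ‖indicial (k : ℂ) i‖ * ‖b i‖ * r ^ i := by gcongr; exact hK i h2
                _ = _ := by ring
        _ ≤ ‖a‖ * r + K * truncNorm r N (nonlinSeries e c k (truncSeries b N)) := by
            rw [Finset.sum_add_distrib, ← Finset.mul_sum]
            gcongr
            · rw [Finset.sum_ite_eq']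
              split_ifs <;> [exact le_rfl; positivity]
            · exact le_rfl
        _ ≤ δ / 2 + δ / 2 := add_le_add hra ((mul_le_mul_of_nonneg_left hG hK₀).trans hδK)
        _ = δ := by ring
  refine ⟨r, hr₀, summable_of_sum_range_le (c := δ) (fun _ => by positivity) fun n => ?_⟩
  refine le_trans (Finset.sum_le_sum fun i _ => ?_) (hS n)
  rcases Nat.eq_zero_or_pos i with rfl | hi
  · simp [hb₀]
  · have h1 : (1 : ℝ) ≤ (i : ℝ) ^ 2 := by
      have : (1 : ℝ) ≤ i := by exact_mod_cast hi
      nlinarith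
    calc _ = 1 * ‖b i‖ * r ^ i := by rw [one_mul]
      _ ≤ _ := by gcongr

/-! ### Taylor series of analytic functions and the Euler operator -/

/-- The Taylor series of a function at the origin. -/
def taylorSeries (f : ℂ → ℂ) : PowerSeries ℂ :=
  PowerSeries.mk fun n => iteratedDeriv n f 0 / n.factorial

theorem coeff_taylorSeries (f : ℂ → ℂ) (n : ℕ) :
    PowerSeries.coeff n (taylorSeries f) = iteratedDeriv n f 0 / n.factorial := by
  simp [taylorSeries]

theorem taylorSeries_mul {f g : ℂ → ℂ} (hf : AnalyticAt ℂ f 0) (hg : AnalyticAt ℂ g 0) :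
    taylorSeries (fun s => f s * g s) = taylorSeries f * taylorSeries g := by
  ext n
  rw [coeff_taylorSeries, PowerSeries.coeff_mul,
    iteratedDeriv_fun_mul hf.contDiffAt hg.contDiffAt,
    Finset.Nat.sum_antidiagonal_eq_sum_range_succ_mk, Finset.sum_div]
  refine Finset.sum_congr rfl fun i hi => ?_
  have hi' : i ≤ n := Nat.lt_succ_iff.mp (Finset.mem_range.mp hi)
  have h1 : (n.factorial : ℂ) ≠ 0 := by exact_mod_cast n.factorial_ne_zero
  have h2 : (i.factorial : ℂ) ≠ 0 := by exact_mod_cast i.factorial_ne_zero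
  have h3 : ((n - i).factorial : ℂ) ≠ 0 := by exact_mod_cast (n - i).factorial_ne_zero
  rw [coeff_taylorSeries, coeff_taylorSeries, Nat.cast_choose ℂ hi']
  field_simp

theorem taylorSeries_add {f g : ℂ → ℂ} (hf : AnalyticAt ℂ f 0) (hg : AnalyticAt ℂ g 0) :
    taylorSeries (fun s => f s + g s) = taylorSeries f + taylorSeries g := by
  ext n
  rw [map_add, coeff_taylorSeries, coeff_taylorSeries, coeff_taylorSeries,
    iteratedDeriv_fun_add hf.contDiffAt hg.contDiffAt, add_div]

theorem taylorSeries_const (c : ℂ) : taylorSeries (fun _ => c) = PowerSeries.C c := by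
  ext n
  rw [coeff_taylorSeries, PowerSeries.coeff_C, iteratedDeriv_const]
  split_ifs with h
  · simp [h]
  · simp

theorem taylorSeries_sub {f g : ℂ → ℂ} (hf : AnalyticAt ℂ f 0) (hg : AnalyticAt ℂ g 0) :
    taylorSeries (fun s => f s - g s) = taylorSeries f - taylorSeries g := by
  rw [eq_sub_iff_add_eq, ← taylorSeries_add (hf.fun_sub hg) hg]
  simp

theorem taylorSeries_deriv (f : ℂ → ℂ) :
    taylorSeries (deriv f) = PowerSeries.derivative ℂ (taylorSeries f) := by
  ext n
  rw [PowerSeries.coeff_derivative, coeff_taylorSeries, coeff_taylorSeries, ← iteratedDeriv_succ',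
    Nat.factorial_succ]
  have h1 : (n.factorial : ℂ) ≠ 0 := by exact_mod_cast n.factorial_ne_zero
  have h2 : (n + 1 : ℂ) ≠ 0 := by exact_mod_cast n.succ_ne_zero
  push_cast
  field_simp

theorem taylorSeries_id : taylorSeries (fun s => s) = PowerSeries.X := by
  ext n
  rw [coeff_taylorSeries, PowerSeries.coeff_X]
  rcases n with _ | n
  · simp
  · have h : deriv (fun s : ℂ => s) = fun _ => 1 := by ext; simp
    rw [iteratedDeriv_succ', h, iteratedDeriv_const]
    rcases n with _ | n <;> simp

theorem eventually_eq_zero_of_taylorSeries {f : ℂ → ℂ} (hf : AnalyticAt ℂ f 0)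
    (h : taylorSeries f = 0) : ∀ᶠ s in 𝓝 0, f s = 0 := by
  have hp := hf.hasFPowerSeriesAt
  have : (fun n : ℕ => iteratedDeriv n f 0 / (n.factorial : ℂ)) = 0 := by
    ext n
    rw [← coeff_taylorSeries, h]
    simp
  rw [this, (FormalMultilinearSeries.ofScalars_series_eq_zero ℂ).mpr rfl] at hp
  exact hp.eventually_eq_zero

theorem taylorSeries_congr {f g : ℂ → ℂ} (h : f =ᶠ[𝓝 0] g) : taylorSeries f = taylorSeries g := by
  ext n
  rw [coeff_taylorSeries, coeff_taylorSeries, h.iteratedDeriv_eq]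

theorem exists_analyticAt_taylorSeries {F : PowerSeries ℂ} {r : ℝ} (hr : 0 < r)
    (h : Summable fun n => ‖PowerSeries.coeff n F‖ * r ^ n) :
    ∃ f : ℂ → ℂ, AnalyticAt ℂ f 0 ∧ taylorSeries f = F := by
  set p := FormalMultilinearSeries.ofScalars ℂ (fun n => PowerSeries.coeff n F) with hp
  lift r to NNReal using hr.le
  have hrad : (r : ENNReal) ≤ p.radius := by
    refine p.le_radius_of_summable_norm ?_
    refine h.congr fun n => ?_
    rw [hp, FormalMultilinearSeries.ofScalars_norm]
  have hpos : 0 < p.radius := lt_of_lt_of_le (by exact_mod_cast hr) hrad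
  have hps : HasFPowerSeriesAt p.sum p 0 := (p.hasFPowerSeriesOnBall hpos).hasFPowerSeriesAt
  refine ⟨p.sum, hps.analyticAt, ?_⟩
  have := hps.analyticAt.hasFPowerSeriesAt.eq_formalMultilinearSeries hps
  have hinj := FormalMultilinearSeries.ofScalars_series_injective ℂ ℂ this
  ext n
  rw [coeff_taylorSeries]
  exact congrFun hinj n

/-- The operator `κ s d/ds` on functions. -/
def eulerFun (κ : ℂ) (f : ℂ → ℂ) (s : ℂ) : ℂ := κ * s * deriv f s

theorem _root_.AnalyticAt.eulerFun {f : ℂ → ℂ} {s : ℂ} (hf : AnalyticAt ℂ f s) (κ : ℂ) :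
    AnalyticAt ℂ (eulerFun κ f) s :=
  (analyticAt_const.mul analyticAt_id).mul hf.deriv

theorem taylorSeries_eulerFun (κ : ℂ) {f : ℂ → ℂ} (hf : AnalyticAt ℂ f 0) :
    taylorSeries (eulerFun κ f) = euler κ (taylorSeries f) := by
  have h : taylorSeries (eulerFun κ f) =
      PowerSeries.C κ * PowerSeries.X * PowerSeries.derivative ℂ (taylorSeries f) := by
    rw [← taylorSeries_deriv, ← taylorSeries_const, ← taylorSeries_id,
      ← taylorSeries_mul (by fun_prop) (by fun_prop), ← taylorSeries_mul (by fun_prop) hf.deriv]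
    rfl
  rw [h]
  ext n
  rw [coeff_euler, mul_assoc, PowerSeries.coeff_C_mul]
  rcases n with _ | n
  · simp
  · rw [PowerSeries.coeff_succ_X_mul, PowerSeries.coeff_derivative]
    push_cast
    ring

/-- The left side of the equation for `x⁻¹ h(x^κ)`, multiplied by `x ^ 4`, as a function of
`x^κ`. -/
def eulerDefect (e κ : ℂ) (h : ℂ → ℂ) (s : ℂ) : ℂ :=
  eulerForm e (h s) (eulerFun κ h s) (eulerFun κ (eulerFun κ h) s)
    (eulerFun κ (eulerFun κ (eulerFun κ h)) s)

theorem analyticAt_eulerDefect (e κ : ℂ) {h : ℂ → ℂ} {s : ℂ} (hh : AnalyticAt ℂ h s) :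
    AnalyticAt ℂ (eulerDefect e κ h) s := by
  have h₁ := hh.eulerFun κ
  have h₂ := h₁.eulerFun κ
  have h₃ := h₂.eulerFun κ
  unfold eulerDefect eulerForm
  fun_prop

theorem taylorSeries_eulerDefect (e κ : ℂ) {h : ℂ → ℂ} (hh : AnalyticAt ℂ h 0) :
    taylorSeries (eulerDefect e κ h) =
      eulerForm (PowerSeries.C e) (taylorSeries h) (euler κ (taylorSeries h))
        (euler κ (euler κ (taylorSeries h))) (euler κ (euler κ (euler κ (taylorSeries h)))) := by
  have h₁ := hh.eulerFun κ
  have h₂ := h₁.eulerFun κ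
  have h₃ := h₂.eulerFun κ
  rw [← taylorSeries_eulerFun κ hh, ← taylorSeries_eulerFun κ h₁, ← taylorSeries_eulerFun κ h₂]
  unfold eulerDefect eulerForm
  set g₁ := eulerFun κ h
  set g₂ := eulerFun κ g₁
  set g₃ := eulerFun κ g₂
  simp only [pow_two]
  have hc : ∀ n : ℕ, ∀ [n.AtLeastTwo], taylorSeries (fun _ => (OfNat.ofNat n : ℂ)) =
      OfNat.ofNat n := fun n _ => by
    rw [taylorSeries_const, map_ofNat]
  rw [← taylorSeries_const]
  simp (disch := fun_prop) only [taylorSeries_sub, taylorSeries_add, taylorSeries_mul, hc]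

theorem exists_eulerDefect_eq_zero {k : ℝ} (hk : 0 < k) {e c : ℂ} (he : e * c * (6 + c) = -1)
    (hκ : (k : ℂ) = 6 + 2 * c) (hP : ∀ n, 2 ≤ n → indicial (k : ℂ) n ≠ 0) (a : ℂ) :
    ∃ h : ℂ → ℂ, AnalyticAt ℂ h 0 ∧ h 0 = c ∧ deriv h 0 = a ∧
      ∀ᶠ s in 𝓝 0, eulerDefect e k h s = 0 := by
  obtain ⟨r, hr, hs⟩ := exists_summable_solCoeff hk e c a hP
  obtain ⟨f, hf, hfT⟩ := exists_analyticAt_taylorSeries (F := PowerSeries.mk (solCoeff e c k a)) hr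
    (by simpa using hs)
  have hT : taylorSeries (fun s => c + f s) =
      PowerSeries.C c + PowerSeries.mk (solCoeff e c k a) := by
    rw [taylorSeries_add analyticAt_const hf, hfT, taylorSeries_const]
  have hh : AnalyticAt ℂ (fun s => c + f s) 0 := analyticAt_const.add hf
  have hf₀ := coeff_taylorSeries f 0
  have hf₁ := coeff_taylorSeries f 1
  rw [hfT, PowerSeries.coeff_mk] at hf₀ hf₁
  rw [solCoeff_zero] at hf₀
  rw [solCoeff_one] at hf₁
  refine ⟨_, hh, ?_, ?_, eventually_eq_zero_of_taylorSeries (analyticAt_eulerDefect _ _ hh) ?_⟩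
  · simpa using hf₀.symm
  · simpa using hf₁.symm
  · have he' : ∀ F, euler (k : ℂ) (PowerSeries.C c + F) = euler (k : ℂ) F := by
      intro F
      ext n
      rcases n with _ | n <;> simp [coeff_euler]
    rw [taylorSeries_eulerDefect _ _ hh, hT, he', eulerForm_eq_zero_iff he hκ]
    exact isFormalSolution_solCoeff hP a

/-- Taking Taylor series is compatible with products and with the Euler operator, so both functions
give formal solutions with the same first two coefficients. Formal uniqueness then applies to the
germs. -/
theorem eventuallyEq_of_eulerDefect_eq_zero {κ e c : ℂ} (he : e * c * (6 + c) = -1)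
    (hκ : κ = 6 + 2 * c) (hP : ∀ n, 2 ≤ n → indicial κ n ≠ 0) {g h : ℂ → ℂ}
    (hg : AnalyticAt ℂ g 0) (hh : AnalyticAt ℂ h 0) (hg₀ : g 0 = c) (hh₀ : h 0 = c)
    (h₁ : deriv g 0 = deriv h 0) (hgE : ∀ᶠ s in 𝓝 0, eulerDefect e κ g s = 0)
    (hhE : ∀ᶠ s in 𝓝 0, eulerDefect e κ h s = 0) : g =ᶠ[𝓝 0] h := by
  have key : ∀ f : ℂ → ℂ, AnalyticAt ℂ f 0 → (∀ᶠ s in 𝓝 0, eulerDefect e κ f s = 0) →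
      IsFormalSolution e c κ (taylorSeries f - PowerSeries.C c) := by
    intro f hf hE
    have hT : taylorSeries (eulerDefect e κ f) = 0 := by
      rw [taylorSeries_congr (g := fun _ => 0) hE, taylorSeries_const, map_zero]
    have he' : ∀ F, euler κ F = euler κ (F - PowerSeries.C c) := by
      intro F
      ext n
      rcases n with _ | n <;> simp [coeff_euler]
    rw [taylorSeries_eulerDefect _ _ hf, he' (taylorSeries f)] at hT
    rw [← eulerForm_eq_zero_iff he hκ]
    simpa using hT
  have heq := (key g hg hgE).eq hP (key h hh hhE) (by rw [map_sub, coeff_taylorSeries]; simp [hg₀])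
    (by rw [map_sub, coeff_taylorSeries]; simp [hh₀]) (by simp [coeff_taylorSeries, h₁])
  have hT : taylorSeries (fun s => g s - h s) = 0 := by
    rw [taylorSeries_sub hg hh]
    linear_combination heq
  filter_upwards [eventually_eq_zero_of_taylorSeries (hg.fun_sub hh) hT] with s hs
  exact sub_eq_zero.mp hs

/-! ### From the differential equation to its Euler form, on any branch -/

theorem iteratedDeriv_eq_of_hasDerivAt {U : Set ℂ} (hU : IsOpen U) {f₀ f₁ f₂ f₃ : ℂ → ℂ}
    (h₀ : ∀ x ∈ U, HasDerivAt f₀ (f₁ x) x) (h₁ : ∀ x ∈ U, HasDerivAt f₁ (f₂ x) x)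
    (h₂ : ∀ x ∈ U, HasDerivAt f₂ (f₃ x) x) {x : ℂ} (hx : x ∈ U) :
    deriv f₀ x = f₁ x ∧ iteratedDeriv 2 f₀ x = f₂ x ∧ iteratedDeriv 3 f₀ x = f₃ x := by
  have key : ∀ {f f' : ℂ → ℂ}, (∀ x ∈ U, HasDerivAt f (f' x) x) → ∀ x ∈ U, deriv f =ᶠ[𝓝 x] f' :=
    fun {f f'} h x hx => by
      filter_upwards [hU.mem_nhds hx] with z hz using (h z hz).deriv
  have e₁ := key h₀
  have e₂ : ∀ x ∈ U, iteratedDeriv 2 f₀ =ᶠ[𝓝 x] f₂ := fun x hx => by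
    rw [iteratedDeriv_succ, iteratedDeriv_one]
    exact (e₁ x hx).deriv.trans (key h₁ x hx)
  refine ⟨(h₀ x hx).deriv, (e₂ x hx).eq_of_nhds, ?_⟩
  rw [iteratedDeriv_succ]
  exact (e₂ x hx).deriv_eq.trans (h₂ x hx).deriv

theorem solvesOn_iff_of_hasDerivAt {k : ℝ} {U : Set ℂ} (hU : IsOpen U) {f₀ f₁ f₂ f₃ : ℂ → ℂ}
    (h₀ : ∀ x ∈ U, HasDerivAt f₀ (f₁ x) x) (h₁ : ∀ x ∈ U, HasDerivAt f₁ (f₂ x) x)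
    (h₂ : ∀ x ∈ U, HasDerivAt f₂ (f₃ x) x) :
    SolvesOn k f₀ U ↔ ∀ x ∈ U, f₃ x - 2 * f₀ x * f₂ x + 3 * f₁ x ^ 2 =
      4 / (36 - (k : ℂ) ^ 2) * (6 * f₁ x - f₀ x ^ 2) ^ 2 := by
  have hd : DifferentiableOn ℂ f₀ U := fun x hx =>
    (h₀ x hx).differentiableAt.differentiableWithinAt
  rw [SolvesOn]
  refine ⟨fun h x hx => ?_, fun h => ⟨hU, hd, fun x hx => ?_⟩⟩
  · have := h.2.2 x hx
    obtain ⟨k₁, k₂, k₃⟩ := iteratedDeriv_eq_of_hasDerivAt hU h₀ h₁ h₂ hx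
    rwa [k₁, k₂, k₃] at this
  · obtain ⟨k₁, k₂, k₃⟩ := iteratedDeriv_eq_of_hasDerivAt hU h₀ h₁ h₂ hx
    rw [k₁, k₂, k₃, h x hx]

theorem SolvesOn.mono {k : ℝ} {y : ℂ → ℂ} {U V : Set ℂ} (h : SolvesOn k y U) (hV : IsOpen V)
    (hVU : V ⊆ U) : SolvesOn k y V :=
  ⟨hV, h.2.1.mono hVU, fun x hx => h.2.2 x (hVU hx)⟩

theorem SolvesOn.congr {k : ℝ} {y z : ℂ → ℂ} {U : Set ℂ} (h : SolvesOn k y U)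
    (hyz : Set.EqOn z y U) : SolvesOn k z U := by
  refine ⟨h.1, h.2.1.congr hyz, fun x hx => ?_⟩
  have hE : z =ᶠ[𝓝 x] y := hyz.eventuallyEq_of_mem (h.1.mem_nhds hx)
  rw [hE.iteratedDeriv_eq, hE.iteratedDeriv_eq, hE.deriv_eq, hE.eq_of_nhds]
  exact h.2.2 x hx

theorem IsLogBranch.ne_zero {L : ℂ → ℂ} {U : Set ℂ} (h : IsLogBranch L U) {x : ℂ} (hx : x ∈ U) :
    x ≠ 0 := by
  rw [← h.2.2 x hx]
  exact Complex.exp_ne_zero _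

theorem IsLogBranch.hasDerivAt {L : ℂ → ℂ} {U : Set ℂ} (h : IsLogBranch L U) {x : ℂ}
    (hx : x ∈ U) : HasDerivAt L x⁻¹ x := by
  have hU := h.1.mem_nhds hx
  have he := Complex.hasDerivAt_exp (L x)
  rw [h.2.2 x hx] at he
  refine HasDerivAt.of_local_left_inverse (h.2.1.continuousAt hU) he (h.ne_zero hx) ?_
  filter_upwards [hU] with z hz using h.2.2 z hz

theorem isLogBranch_log : IsLogBranch Complex.log Complex.slitPlane :=
  ⟨Complex.isOpen_slitPlane, fun _ hx => (continuousAt_clog hx).continuousWithinAt,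
    fun _ hx => Complex.exp_log (Complex.slitPlane_ne_zero hx)⟩

theorem IsLogBranch.mono {L : ℂ → ℂ} {U V : Set ℂ} (h : IsLogBranch L U) (hV : IsOpen V)
    (hVU : V ⊆ U) : IsLogBranch L V :=
  ⟨hV, h.2.1.mono hVU, fun x hx => h.2.2 x (hVU hx)⟩

/-- Since k is real, the modulus of x^k does not depend on the branch. Hence one radius serves all
branches. -/
theorem IsLogBranch.norm_exp_mul {L : ℂ → ℂ} {U : Set ℂ} (h : IsLogBranch L U) (k : ℝ) {x : ℂ}
    (hx : x ∈ U) : ‖Complex.exp (k * L x)‖ = ‖x‖ ^ k := by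
  conv_rhs => rw [← h.2.2 x hx]
  rw [Complex.norm_exp, Complex.norm_exp, ← Real.exp_mul, Complex.re_ofReal_mul, mul_comm]

theorem hasDerivAt_inv_pow_mul_comp {κ x : ℂ} {s φ : ℂ → ℂ} (hx : x ≠ 0)
    (hs : HasDerivAt s (κ * x⁻¹ * s x) x) (hφ : AnalyticAt ℂ φ (s x)) (m : ℕ) :
    HasDerivAt (fun z => z⁻¹ ^ m * φ (s z))
      (x⁻¹ ^ (m + 1) * (eulerFun κ φ (s x) - m * φ (s x))) x := by
  have h₁ := (hasDerivAt_inv hx).fun_pow m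
  have h₂ := hφ.differentiableAt.hasDerivAt.comp x hs
  refine (h₁.mul h₂).congr_deriv ?_
  unfold eulerFun
  rcases m with _ | m
  · simp
    ring
  · simp only [Function.comp, Nat.cast_add, Nat.cast_one, Nat.add_sub_cancel]
    ring

/-- Differentiating x^(-m) φ(x^k) gives x^(-m-1) (θ-m)φ. Three derivatives therefore yield (θ-1),
(θ-1)(θ-2), (θ-1)(θ-2)(θ-3), and the equation is x^(-4) times the Euler defect. -/
theorem solvesOn_powerForm_iff {k : ℝ} {L h : ℂ → ℂ} {U : Set ℂ} (hL : IsLogBranch L U)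
    (hh : ∀ x ∈ U, AnalyticAt ℂ h (Complex.exp (k * L x))) :
    SolvesOn k (powerForm k h L) U ↔
      ∀ x ∈ U, eulerDefect (4 / (36 - (k : ℂ) ^ 2)) k h (Complex.exp (k * L x)) = 0 := by
  set s : ℂ → ℂ := fun x => Complex.exp (k * L x) with hs
  have hsd : ∀ x ∈ U, HasDerivAt s (k * x⁻¹ * s x) x := fun x hx => by
    have := ((hL.hasDerivAt hx).const_mul (k : ℂ)).cexp
    exact this.congr_deriv (by ring)
  set g₁ := eulerFun (k : ℂ) h with hg₁
  set g₂ := eulerFun (k : ℂ) g₁ with hg₂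
  set g₃ := eulerFun (k : ℂ) g₂ with hg₃
  have a₁ : ∀ x ∈ U, AnalyticAt ℂ g₁ (s x) := fun x hx => (hh x hx).eulerFun _
  have a₂ : ∀ x ∈ U, AnalyticAt ℂ g₂ (s x) := fun x hx => (a₁ x hx).eulerFun _
  have d := fun x (hx : x ∈ U) (φ : ℂ → ℂ) (hφ : AnalyticAt ℂ φ (s x)) (m : ℕ) =>
    hasDerivAt_inv_pow_mul_comp (hL.ne_zero hx) (hsd x hx) hφ m
  have h₀ : ∀ x ∈ U, HasDerivAt (powerForm k h L)
      ((fun x => x⁻¹ ^ 2 * g₁ (s x) - x⁻¹ ^ 2 * h (s x)) x) x := fun x hx => by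
    have := d x hx h (hh x hx) 1
    simp only [pow_one] at this
    exact this.congr_deriv (by push_cast; ring)
  have h₁ : ∀ x ∈ U, HasDerivAt (fun x => x⁻¹ ^ 2 * g₁ (s x) - x⁻¹ ^ 2 * h (s x))
      ((fun x => x⁻¹ ^ 3 * g₂ (s x) - 3 * (x⁻¹ ^ 3 * g₁ (s x)) + 2 * (x⁻¹ ^ 3 * h (s x))) x) x :=
    fun x hx => by
      refine ((d x hx g₁ (a₁ x hx) 2).sub (d x hx h (hh x hx) 2)).congr_deriv ?_
      push_cast
      ring
  have h₂ : ∀ x ∈ U, HasDerivAt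
      (fun x => x⁻¹ ^ 3 * g₂ (s x) - 3 * (x⁻¹ ^ 3 * g₁ (s x)) + 2 * (x⁻¹ ^ 3 * h (s x)))
      ((fun x => x⁻¹ ^ 4 * (g₃ (s x) - 6 * g₂ (s x) + 11 * g₁ (s x) - 6 * h (s x))) x) x :=
    fun x hx => by
      refine (((d x hx g₂ (a₂ x hx) 3).sub ((d x hx g₁ (a₁ x hx) 3).const_mul 3)).add
        ((d x hx h (hh x hx) 3).const_mul 2)).congr_deriv ?_
      push_cast
      ring
  rw [solvesOn_iff_of_hasDerivAt hL.1 h₀ h₁ h₂]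
  refine forall₂_congr fun x hx => ?_
  have hx4 : x⁻¹ ^ 4 ≠ 0 := pow_ne_zero _ (inv_ne_zero (hL.ne_zero hx))
  rw [← sub_eq_zero, ← or_iff_right (a := x⁻¹ ^ 4 = 0) (b := eulerDefect _ _ _ _ = 0) hx4,
    ← mul_eq_zero, iff_iff_eq]
  congr 1
  simp only [powerForm, eulerDefect, eulerForm, ← hg₁, ← hg₂, ← hg₃, hs]
  ring

theorem exists_radius_rpow_lt {k ρ : ℝ} (hk : 0 < k) (hρ : 0 < ρ) :
    ∃ r : ℝ, 0 < r ∧ ∀ x : ℂ, x ∈ Metric.ball (0 : ℂ) r → ‖x‖ ^ k < ρ := by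
  refine ⟨ρ ^ k⁻¹, by positivity, fun x hx => ?_⟩
  rw [mem_ball_zero_iff] at hx
  calc ‖x‖ ^ k < (ρ ^ k⁻¹) ^ k := Real.rpow_lt_rpow (norm_nonneg _) hx hk
    _ = ρ := Real.rpow_inv_rpow hρ.le hk.ne'

theorem solvesAllBranches_of_eulerDefect {k : ℝ} (hk : 0 < k) {h : ℂ → ℂ} (hh : AnalyticAt ℂ h 0)
    (hE : ∀ᶠ s in 𝓝 0, eulerDefect (4 / (36 - (k : ℂ) ^ 2)) k h s = 0) :
    SolvesAllBranches k h := by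
  obtain ⟨ρ, hρ, hball⟩ := Metric.eventually_nhds_iff_ball.mp (hh.eventually_analyticAt.and hE)
  obtain ⟨r, hr, hrk⟩ := exists_radius_rpow_lt hk hρ
  refine ⟨r, hr, fun U L hU hL => ?_⟩
  have hmem : ∀ x ∈ U, Complex.exp (k * L x) ∈ Metric.ball (0 : ℂ) ρ := fun x hx => by
    rw [mem_ball_zero_iff, hL.norm_exp_mul k hx]
    exact hrk x (hU hx)
  exact (solvesOn_powerForm_iff hL fun x hx => (hball _ (hmem x hx)).1).mpr
    fun x hx => (hball _ (hmem x hx)).2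

/-- On small positive x the values x^k are positive reals accumulating at 0. The defect is analytic
at 0 and vanishes on them, so it vanishes near 0 by the identity theorem. -/
theorem SolvesPrincipalBranch.eulerDefect_eq_zero {k : ℝ} (hk : 0 < k) {h : ℂ → ℂ}
    (hh : AnalyticAt ℂ h 0) (hS : SolvesPrincipalBranch k h) :
    ∀ᶠ s in 𝓝 0, eulerDefect (4 / (36 - (k : ℂ) ^ 2)) k h s = 0 := by
  obtain ⟨ρ, hρ, hball⟩ := Metric.eventually_nhds_iff_ball.mp hh.eventually_analyticAt
  obtain ⟨r, hr, hrk⟩ := exists_radius_rpow_lt hk hρ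
  obtain ⟨r', hr', hS⟩ := hS
  set U : Set ℂ := Metric.ball 0 (min r r') ∩ Complex.slitPlane with hU
  have hUo : IsOpen U := Metric.isOpen_ball.inter Complex.isOpen_slitPlane
  have hL : IsLogBranch Complex.log U := isLogBranch_log.mono hUo Set.inter_subset_right
  have hS' : SolvesOn k (powerForm k h Complex.log) U :=
    hS.mono hUo (Set.inter_subset_inter_left _ (Metric.ball_subset_ball (min_le_right _ _)))
  rw [solvesOn_powerForm_iff hL fun x hx => hball _ (by
    rw [mem_ball_zero_iff, hL.norm_exp_mul k hx]
    exact hrk x (Metric.ball_subset_ball (min_le_left _ _) hx.1))] at hS'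
  rw [← (analyticAt_eulerDefect _ _ hh).frequently_zero_iff_eventually_zero]
  have ht : Tendsto (fun x : ℝ => (((x ^ k : ℝ)) : ℂ)) (𝓝[>] 0) (𝓝[≠] 0) := by
    refine tendsto_nhdsWithin_iff.mpr ⟨?_, ?_⟩
    · have h1 : ContinuousAt (fun x : ℝ => (((x ^ k : ℝ)) : ℂ)) 0 :=
        Complex.continuous_ofReal.continuousAt.comp (Real.continuousAt_rpow_const 0 k (Or.inr hk.le))
      have h2 := h1.tendsto
      simp only [Real.zero_rpow hk.ne', Complex.ofReal_zero] at h2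
      exact h2.mono_left nhdsWithin_le_nhds
    · filter_upwards [self_mem_nhdsWithin] with x hx
      have : 0 < x ^ k := Real.rpow_pos_of_pos hx k
      simpa using this.ne'
  refine ht.frequently (Eventually.frequently ?_)
  have hm : 0 < min r r' := lt_min hr hr'
  filter_upwards [Ioo_mem_nhdsGT hm] with x hx
  have hxU : (x : ℂ) ∈ U := by
    refine ⟨?_, Complex.ofReal_mem_slitPlane.mpr hx.1⟩
    rw [mem_ball_zero_iff, Complex.norm_real, Real.norm_of_nonneg hx.1.le]
    exact hx.2
  have := hS' _ hxU
  rwa [← Complex.ofReal_log hx.1.le, ← Complex.ofReal_mul, ← Complex.ofReal_exp, mul_comm,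
    ← Real.rpow_def_of_pos hx.1] at this

theorem indicial_ne_zero {k : ℝ} (hk : 0 < k) (hk_inv : ∀ n : ℕ, k ≠ 1 / (n : ℝ)) (n : ℕ)
    (hn : 2 ≤ n) : indicial (k : ℂ) n ≠ 0 := by
  have h2 : (2 : ℝ) ≤ n := by exact_mod_cast hn
  have : indicial (k : ℂ) n = (((n - 1) * k * (n ^ 2 * k ^ 2 - 1) : ℝ) : ℂ) := by
    simp [indicial]
  rw [this, Complex.ofReal_ne_zero]
  refine mul_ne_zero (mul_ne_zero (by linarith) hk.ne') fun h => hk_inv n ?_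
  have h' : (n * k - 1) * (n * k + 1) = 0 := by linear_combination h
  have : n * k + 1 ≠ 0 := by positivity
  have := (mul_eq_zero.mp h').resolve_right this
  field_simp
  linarith

theorem const_solution {k : ℝ} (hk : 0 < k) (hk_six : k ≠ 6) :
    4 / (36 - (k : ℂ) ^ 2) * (((k : ℂ) - 6) / 2) * (6 + ((k : ℂ) - 6) / 2) = -1 := by
  have h1 : (36 - (k : ℂ) ^ 2) ≠ 0 := by
    have : (36 - k ^ 2 : ℝ) ≠ 0 := by
      have : (6 - k) * (6 + k) ≠ 0 := mul_ne_zero (sub_ne_zero.mpr hk_six.symm) (by positivity)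
      intro h; apply this; linarith
    exact_mod_cast this
  field_simp
  ring

theorem exists_solvesAllBranches {k : ℝ} (hk : 0 < k) (hk_six : k ≠ 6)
    (hk_inv : ∀ n : ℕ, k ≠ 1 / (n : ℝ)) (a : ℂ) :
    ∃ h : ℂ → ℂ, (AnalyticAt ℂ h 0 ∧ h 0 = ((k : ℂ) - 6) / 2 ∧ deriv h 0 = a ∧
        SolvesAllBranches k h) ∧
      ∀ h₁ : ℂ → ℂ, AnalyticAt ℂ h₁ 0 → h₁ 0 = ((k : ℂ) - 6) / 2 → deriv h₁ 0 = a →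
        SolvesPrincipalBranch k h₁ → h₁ =ᶠ[𝓝 0] h := by
  have hP := indicial_ne_zero hk hk_inv
  have he := const_solution hk hk_six
  have hκ : (k : ℂ) = 6 + 2 * (((k : ℂ) - 6) / 2) := by ring
  obtain ⟨h, hh, h₀, h₁, hE⟩ := exists_eulerDefect_eq_zero hk he hκ hP a
  refine ⟨h, ⟨hh, h₀, h₁, solvesAllBranches_of_eulerDefect hk hh hE⟩, fun g hg hg₀ hg₁ hS => ?_⟩
  exact eventuallyEq_of_eulerDefect_eq_zero he hκ hP hg hh hg₀ h₀ (hg₁.trans h₁.symm)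
    (hS.eulerDefect_eq_zero hk hg) hE

/-! ### The Cole–Hopf transform and its polynomial solutions -/

/-- Here pᵢ stands for u⁽ⁱ⁾/u. After multiplication by 6+c, `he` turns the right side into
-c(6p₂-(6+c)p₁²)². Its p₁⁴ and p₁²p₂ terms match the left side, and the surviving p₂² coefficient is
3(c+2)(c+3), which fixes K. -/
theorem colehopf_identity {c e K p₁ p₂ p₃ p₄ : ℂ} (he : e * c * (6 + c) = -1)
    (hK : K * (6 + c) = 3 * (3 + c) * (2 + c)) (h6 : 6 + c ≠ 0)
    (h : p₄ - (4 + 2 * c) * p₁ * p₃ + K * p₂ ^ 2 = 0) :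
    c * (p₄ - 4 * p₁ * p₃ - 3 * p₂ ^ 2 + 12 * p₁ ^ 2 * p₂ - 6 * p₁ ^ 4)
      - 2 * (c * p₁) * (c * (p₃ - 3 * p₁ * p₂ + 2 * p₁ ^ 3)) + 3 * (c * (p₂ - p₁ ^ 2)) ^ 2
      = e * (6 * (c * (p₂ - p₁ ^ 2)) - (c * p₁) ^ 2) ^ 2 := by
  rw [← mul_right_inj' h6]
  linear_combination (6 + c) * c * h - c * p₂ ^ 2 * hK
    - c * (6 * p₂ - (6 + c) * p₁ ^ 2) ^ 2 * he

theorem solvesColeHopf_iff (k : ℝ) (u : ℂ[X]) : SolvesColeHopf k u ↔ ∀ x,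
    u.eval x * (derivative (derivative (derivative (derivative u)))).eval x
      - ((k : ℂ) - 2) * (derivative u).eval x * (derivative (derivative (derivative u))).eval x
      + 3 * (k : ℂ) * ((k : ℂ) - 2) / (2 * ((k : ℂ) + 6)) * (derivative (derivative u)).eval x ^ 2
      = 0 := by
  rw [SolvesColeHopf]
  simp only [Function.iterate_succ, Function.iterate_zero, Function.comp_apply, id]
  constructor
  · intro h x
    have := congrArg (Polynomial.eval x) h
    rw [eval_add, eval_sub, eval_mul, eval_mul, eval_mul, eval_mul, eval_pow, eval_C,
      eval_C, eval_zero] at this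
    exact this
  · intro h
    refine Polynomial.funext fun x => ?_
    rw [eval_add, eval_sub, eval_mul, eval_mul, eval_mul, eval_mul, eval_pow, eval_C,
      eval_C, eval_zero]
    exact h x

theorem solvesOn_coleHopf {k : ℝ} (hk : 0 < k) (hk_six : k ≠ 6) {u : ℂ[X]}
    (hu : SolvesColeHopf k u) : SolvesOn k (coleHopf k u) {x | u.eval x ≠ 0} := by
  have hU : IsOpen {x : ℂ | u.eval x ≠ 0} := isOpen_ne_fun u.continuous continuous_const
  set c : ℂ := ((k : ℂ) - 6) / 2 with hc
  set u₁ := derivative u with hu₁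
  set u₂ := derivative u₁ with hu₂
  set u₃ := derivative u₂ with hu₃
  set u₄ := derivative u₃ with hu₄
  have d : ∀ (p : ℂ[X]), ∀ x ∈ {x : ℂ | u.eval x ≠ 0},
      HasDerivAt (fun x => p.eval x / u.eval x)
        (p.derivative.eval x / u.eval x - (u₁.eval x / u.eval x) * (p.eval x / u.eval x)) x := by
    intro p x hx
    have hx' : u.eval x ≠ 0 := hx
    refine ((p.hasDerivAt x).div (u.hasDerivAt x) hx').congr_deriv ?_
    rw [hu₁]
    field_simp
  have d₁ := d u₁
  have d₂ := d u₂
  have d₃ := d u₃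
  set p₁ : ℂ → ℂ := fun x => u₁.eval x / u.eval x with hp₁
  set p₂ : ℂ → ℂ := fun x => u₂.eval x / u.eval x with hp₂
  set p₃ : ℂ → ℂ := fun x => u₃.eval x / u.eval x with hp₃
  have h₀ : ∀ x ∈ {x : ℂ | u.eval x ≠ 0}, HasDerivAt (coleHopf k u)
      ((fun x => c * (p₂ x - p₁ x ^ 2)) x) x := fun x hx =>
    ((d₁ x hx).const_mul c).congr_deriv (by simp only [hp₁, hp₂]; ring)
  have h₁ : ∀ x ∈ {x : ℂ | u.eval x ≠ 0}, HasDerivAt (fun x => c * (p₂ x - p₁ x ^ 2))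
      ((fun x => c * (p₃ x - 3 * p₁ x * p₂ x + 2 * p₁ x ^ 3)) x) x := fun x hx =>
    (((d₂ x hx).sub ((d₁ x hx).fun_pow 2)).const_mul c).congr_deriv
      (by simp only [hp₁, hp₂, hp₃]; push_cast; ring)
  have h₂ : ∀ x ∈ {x : ℂ | u.eval x ≠ 0},
      HasDerivAt (fun x => c * (p₃ x - 3 * p₁ x * p₂ x + 2 * p₁ x ^ 3))
      ((fun x => c * (u₄.eval x / u.eval x - 4 * p₁ x * p₃ x - 3 * p₂ x ^ 2
        + 12 * p₁ x ^ 2 * p₂ x - 6 * p₁ x ^ 4)) x) x := fun x hx =>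
    (((((d₃ x hx).sub (((d₁ x hx).const_mul 3).mul (d₂ x hx))).add
      (((d₁ x hx).fun_pow 3).const_mul 2))).const_mul c).congr_deriv
      (by simp only [hp₁, hp₂, hp₃]; push_cast; ring)
  rw [solvesOn_iff_of_hasDerivAt hU h₀ h₁ h₂]
  intro x hx
  have hx' : u.eval x ≠ 0 := hx
  have h6' : ((k : ℂ) + 6) ≠ 0 := by
    have : (k + 6 : ℝ) ≠ 0 := by positivity
    exact_mod_cast this
  have h6 : 6 + c ≠ 0 := by
    rw [hc]
    intro h
    apply h6'
    linear_combination 2 * h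
  have hE := (solvesColeHopf_iff k u).mp hu x
  simp only [← hu₁, ← hu₂, ← hu₃, ← hu₄] at hE
  refine colehopf_identity (K := 3 * (k : ℂ) * ((k : ℂ) - 2) / (2 * ((k : ℂ) + 6)))
    (const_solution hk hk_six) ?_ h6 ?_
  · rw [hc]
    field_simp
    ring
  · have : (k : ℂ) - 2 = 4 + 2 * c := by rw [hc]; ring
    rw [this] at hE ⊢
    generalize 3 * (k : ℂ) * (4 + 2 * c) / (2 * ((k : ℂ) + 6)) = K at hE ⊢
    simp only [hp₁, hp₂, hp₃]
    field_simp
    linear_combination hE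

theorem natDegree_X_mul_comp_X_pow_le {q : ℂ[X]} {m n d : ℕ} (hq : q.natDegree ≤ m)
    (hd : m * n + 1 ≤ d) : (X * q.comp (X ^ n)).natDegree ≤ d := by
  refine natDegree_mul_le.trans ?_
  rw [natDegree_comp, natDegree_X_pow, natDegree_X, add_comm]
  exact le_trans (by gcongr) hd

theorem solvesColeHopf_two (c : ℂ) : SolvesColeHopf 2 (X * (1 + C c * X).comp (X ^ 2)) := by
  rw [solvesColeHopf_iff]
  intro x
  simp [derivative_pow]

theorem solvesColeHopf_three (c : ℂ) : SolvesColeHopf 3 (X * (1 + C c * X).comp (X ^ 3)) := by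
  rw [solvesColeHopf_iff]
  intro x
  simp [derivative_pow]
  ring

theorem solvesColeHopf_four (c : ℂ) : SolvesColeHopf 4 (X * (1 + C c * X).comp (X ^ 4)) := by
  rw [solvesColeHopf_iff]
  intro x
  simp [derivative_pow]
  ring

/-- Up to scaling this is Klein's icosahedral form x(1 + 11t - t²). Putting t = cx⁵/11 gives the
coefficient -c²/121. -/
theorem solvesColeHopf_five (c : ℂ) :
    SolvesColeHopf 5 (X * (1 + C c * X + C (-c ^ 2 / 121) * X ^ 2).comp (X ^ 5)) := by
  rw [solvesColeHopf_iff]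
  intro x
  simp [derivative_pow]
  ring

/-- The number d = 12/(6-k) is 3, 4, 6, 12. For k = 4, 5 the degree of u stays below d, so as a form
of degree d it also vanishes at infinity. -/
theorem exists_polynomial_solvesColeHopf {k : ℝ} (hk : k = 2 ∨ k = 3 ∨ k = 4 ∨ k = 5) (c : ℂ) :
    ∃ (n d : ℕ) (q : ℂ[X]), k = n ∧ 2 ≤ n ∧ (d : ℂ) * (((k : ℂ) - 6) / 2) = -6 ∧
      q.eval 0 = 1 ∧ q.derivative.eval 0 = c ∧ (X * q.comp (X ^ n)).natDegree ≤ d ∧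
      SolvesColeHopf k (X * q.comp (X ^ n)) := by
  have h₁ : (1 + C c * X : ℂ[X]).natDegree ≤ 1 := by compute_degree
  have h₂ : (1 + C c * X + C (-c ^ 2 / 121) * X ^ 2 : ℂ[X]).natDegree ≤ 2 := by compute_degree
  rcases hk with rfl | rfl | rfl | rfl
  · exact ⟨2, 3, _, by norm_num, by norm_num, by push_cast; norm_num, by simp, by simp,
      natDegree_X_mul_comp_X_pow_le h₁ (by norm_num), solvesColeHopf_two c⟩
  · exact ⟨3, 4, _, by norm_num, by norm_num, by push_cast; norm_num, by simp, by simp,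
      natDegree_X_mul_comp_X_pow_le h₁ (by norm_num), solvesColeHopf_three c⟩
  · exact ⟨4, 6, _, by norm_num, by norm_num, by push_cast; norm_num, by simp, by simp,
      natDegree_X_mul_comp_X_pow_le h₁ (by norm_num), solvesColeHopf_four c⟩
  · exact ⟨5, 12, _, by norm_num, by norm_num, by push_cast; norm_num, by simp, by simp,
      natDegree_X_mul_comp_X_pow_le h₂ (by norm_num), solvesColeHopf_five c⟩

theorem analyticAt_eval (p : ℂ[X]) (z : ℂ) : AnalyticAt ℂ (fun x => p.eval x) z :=
  p.differentiable.analyticAt z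

theorem analyticAt_coleHopf (k : ℝ) {u : ℂ[X]} {z : ℂ} (hz : u.eval z ≠ 0) :
    AnalyticAt ℂ (coleHopf k u) z :=
  analyticAt_const.mul ((analyticAt_eval _ z).div (analyticAt_eval u z) hz)

/-- The function `g` with `coleHopf k u x = x⁻¹ g(x^n)` for `u = X q(X^n)`. -/
def profile (c : ℂ) (n : ℕ) (q : ℂ[X]) (s : ℂ) : ℂ :=
  c * (1 + n * s * (q.derivative.eval s / q.eval s))

theorem analyticAt_profile (c : ℂ) (n : ℕ) {q : ℂ[X]} {s : ℂ} (hs : q.eval s ≠ 0) :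
    AnalyticAt ℂ (profile c n q) s :=
  analyticAt_const.mul (analyticAt_const.add ((analyticAt_const.mul analyticAt_id).mul
    ((analyticAt_eval _ s).div (analyticAt_eval q s) hs)))

theorem deriv_profile_zero (c : ℂ) (n : ℕ) {q : ℂ[X]} (hq : q.eval 0 = 1) :
    deriv (profile c n q) 0 = c * n * q.derivative.eval 0 := by
  have hq' : q.eval 0 ≠ 0 := by rw [hq]; exact one_ne_zero
  have h₁ := ((analyticAt_eval q.derivative 0).fun_div (analyticAt_eval q 0)
    hq').differentiableAt.hasDerivAt
  have h₂ := ((((hasDerivAt_id (0 : ℂ)).const_mul (n : ℂ)).mul h₁).const_add 1).const_mul c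
  refine (h₂.congr_deriv ?_).deriv
  simp [hq]
  ring

theorem coleHopf_eq_profile (k : ℝ) (n : ℕ) (q : ℂ[X]) {x : ℂ} (hx : x ≠ 0)
    (hq : q.eval (x ^ n) ≠ 0) :
    coleHopf k (X * q.comp (X ^ n)) x = x⁻¹ * profile (((k : ℂ) - 6) / 2) n q (x ^ n) := by
  rw [coleHopf, profile]
  rcases n with _ | n
  · simp only [pow_zero, derivative_mul, derivative_X, derivative_comp, derivative_one,
      eval_add, eval_mul, eval_comp, eval_one, eval_X, eval_zero] at hq ⊢
    field_simp
    push_cast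
    ring
  · simp only [derivative_mul, derivative_X, derivative_comp, derivative_X_pow, eval_add, eval_mul,
      eval_comp, eval_one, eval_X, eval_pow, eval_C, Nat.add_sub_cancel] at hq ⊢
    field_simp
    ring

theorem eventually_eval_pow_ne_zero {n : ℕ} (hn : n ≠ 0) {q : ℂ[X]} (hq : q.eval 0 = 1) :
    ∀ᶠ x : ℂ in 𝓝 0, q.eval (x ^ n) ≠ 0 := by
  have h : ContinuousAt (fun x : ℂ => q.eval (x ^ n)) 0 :=
    (q.continuous.comp (continuous_pow n)).continuousAt
  refine h.eventually_ne ?_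
  rw [zero_pow hn, hq]
  exact one_ne_zero

theorem solvesPrincipalBranch_profile {k : ℝ} (hk : 0 < k) (hk_six : k ≠ 6) {n : ℕ} (hn : k = n)
    {q : ℂ[X]} (hq : q.eval 0 = 1) (hu : SolvesColeHopf k (X * q.comp (X ^ n))) :
    SolvesPrincipalBranch k (profile (((k : ℂ) - 6) / 2) n q) := by
  have hn₀ : n ≠ 0 := by rintro rfl; simp [hn] at hk
  obtain ⟨r, hr, hball⟩ :=
    Metric.eventually_nhds_iff_ball.mp (eventually_eval_pow_ne_zero hn₀ hq)
  refine ⟨r, hr, ((solvesOn_coleHopf hk hk_six hu).mono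
    (Metric.isOpen_ball.inter Complex.isOpen_slitPlane) fun x hx => ?_).congr fun x hx => ?_⟩
  · simpa using ⟨Complex.slitPlane_ne_zero hx.2, hball x hx.1⟩
  · have hx₀ := Complex.slitPlane_ne_zero hx.2
    rw [coleHopf_eq_profile k n q hx₀ (hball x hx.1), powerForm, hn, Complex.ofReal_natCast,
      Complex.exp_nat_mul, Complex.exp_log hx₀]

/-! ### Covariance under Möbius transformations -/

theorem hasDerivAt_affine_inv_pow_mul_comp {α β γ δ x : ℂ} {φ : ℂ → ℂ} {φ' : ℂ}
    (hv : γ * x + δ ≠ 0) (hφ : HasDerivAt φ φ' ((α * x + β) / (γ * x + δ))) (m : ℕ) :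
    HasDerivAt (fun z => (γ * z + δ)⁻¹ ^ m * φ ((α * z + β) / (γ * z + δ)))
      ((α * δ - β * γ) * ((γ * x + δ)⁻¹ ^ (m + 2) * φ')
        - m * γ * ((γ * x + δ)⁻¹ ^ (m + 1) * φ ((α * x + β) / (γ * x + δ)))) x := by
  have hvd : HasDerivAt (fun z => γ * z + δ) γ x := by
    simpa using ((hasDerivAt_id x).const_mul γ).add_const δ
  have hwd : HasDerivAt (fun z => α * z + β) α x := by
    simpa using ((hasDerivAt_id x).const_mul α).add_const β
  have h := ((hvd.fun_inv hv).fun_pow m).mul (hφ.comp x (hwd.fun_div hvd hv))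
  refine h.congr_deriv ?_
  simp only [Function.comp]
  generalize φ ((α * x + β) / (γ * x + δ)) = Y
  have e1 : (α * (γ * x + δ) - (α * x + β) * γ) / (γ * x + δ) ^ 2 =
      (α * δ - β * γ) * (γ * x + δ)⁻¹ ^ 2 := by
    field_simp
    ring
  rw [e1, div_eq_mul_inv (-γ), ← inv_pow]
  rcases m with _ | m
  · simp
    ring
  · simp only [Nat.add_sub_cancel]
    push_cast
    ring

/-- The shift -6γ/(γx+δ) cancels all lower-order terms. The expression 6y'-y² is multiplied by
D²(γx+δ)⁻⁴ and each side of the equation by D⁴(γx+δ)⁻⁸, where D is the determinant. -/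
theorem SolvesOn.slAction {k : ℝ} {y : ℂ → ℂ} {U : Set ℂ} (hy : SolvesOn k y U)
    {M : Matrix (Fin 2) (Fin 2) ℂ} :
    SolvesOn k (slAction M y) {x | M 1 0 * x + M 1 1 ≠ 0 ∧
      (M 0 0 * x + M 0 1) / (M 1 0 * x + M 1 1) ∈ U} := by
  obtain ⟨hU, hd, hE⟩ := hy
  set α := M 0 0 with hα
  set β := M 0 1 with hβ
  set γ := M 1 0 with hγ
  set δ := M 1 1 with hδ
  set V := {x | γ * x + δ ≠ 0 ∧ (α * x + β) / (γ * x + δ) ∈ U} with hV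
  have hVo : IsOpen V := by
    rw [isOpen_iff_mem_nhds]
    rintro x ⟨hx, hxU⟩
    have h₁ : ContinuousAt (fun x => γ * x + δ) x := by fun_prop
    have h₂ : ContinuousAt (fun x => (α * x + β) / (γ * x + δ)) x :=
      ContinuousAt.div (by fun_prop) h₁ hx
    filter_upwards [h₁.eventually_ne hx, h₂ (hU.mem_nhds hxU)] with z hz hz' using ⟨hz, hz'⟩
  have han : ∀ z ∈ U, AnalyticAt ℂ y z := fun z hz => hd.analyticAt (hU.mem_nhds hz)
  have hy₁ : ∀ z ∈ U, HasDerivAt y (deriv y z) z := fun z hz =>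
    (han z hz).differentiableAt.hasDerivAt
  have hy₂ : ∀ z ∈ U, HasDerivAt (deriv y) (iteratedDeriv 2 y z) z := fun z hz => by
    rw [iteratedDeriv_succ, iteratedDeriv_one]
    exact (han z hz).deriv.differentiableAt.hasDerivAt
  have hy₃ : ∀ z ∈ U, HasDerivAt (iteratedDeriv 2 y) (iteratedDeriv 3 y z) z := fun z hz => by
    rw [iteratedDeriv_succ (n := 2)]
    rw [iteratedDeriv_succ, iteratedDeriv_one]
    exact (han z hz).deriv.deriv.differentiableAt.hasDerivAt
  set y₁ := deriv y
  set y₂ := iteratedDeriv 2 y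
  set y₃ := iteratedDeriv 3 y
  set D := α * δ - β * γ with hD
  set v : ℂ → ℂ := fun x => γ * x + δ with hv
  set w : ℂ → ℂ := fun x => (α * x + β) / (γ * x + δ) with hw
  have d : ∀ {φ φ' : ℂ → ℂ}, (∀ z ∈ U, HasDerivAt φ (φ' z) z) → ∀ (m : ℕ), ∀ x ∈ V,
      HasDerivAt (fun z => (v z)⁻¹ ^ m * φ (w z)) (D * ((v x)⁻¹ ^ (m + 2) * φ' (w x))
        - m * γ * ((v x)⁻¹ ^ (m + 1) * φ (w x))) x := fun {φ φ'} hφ m x hx =>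
    hasDerivAt_affine_inv_pow_mul_comp hx.1 (hφ _ hx.2) m
  have d' : ∀ (m : ℕ), ∀ x ∈ V, HasDerivAt (fun z => (v z)⁻¹ ^ m)
      (-(m * γ * (v x)⁻¹ ^ (m + 1))) x := fun m x hx => by
    have := d (φ := fun _ => 1) (φ' := fun _ => 0) (fun z _ => hasDerivAt_const z 1) m x hx
    simpa using this
  have hdet : M.det = D := by rw [Matrix.det_fin_two, hD, hα, hβ, hγ, hδ]
  have e₀ : ClassXII.slAction M y = fun x => D * ((v x)⁻¹ ^ 2 * y (w x)) - 6 * γ * (v x)⁻¹ ^ 1 := by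
    funext x
    simp only [ClassXII.slAction, hdet, hw, hv, ← hα, ← hβ, ← hγ, ← hδ]
    rw [div_eq_mul_inv D, ← inv_pow]
    ring
  rw [e₀]
  have h₀ : ∀ x ∈ V, HasDerivAt (fun x => D * ((v x)⁻¹ ^ 2 * y (w x)) - 6 * γ * (v x)⁻¹ ^ 1)
      ((fun x => D ^ 2 * ((v x)⁻¹ ^ 4 * y₁ (w x)) - 2 * γ * D * ((v x)⁻¹ ^ 3 * y (w x))
        + 6 * γ ^ 2 * (v x)⁻¹ ^ 2) x) x := fun x hx =>
    (((d hy₁ 2 x hx).const_mul D).sub ((d' 1 x hx).const_mul (6 * γ))).congr_deriv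
      (by push_cast; ring)
  have h₁ : ∀ x ∈ V, HasDerivAt (fun x => D ^ 2 * ((v x)⁻¹ ^ 4 * y₁ (w x))
        - 2 * γ * D * ((v x)⁻¹ ^ 3 * y (w x)) + 6 * γ ^ 2 * (v x)⁻¹ ^ 2)
      ((fun x => D ^ 3 * ((v x)⁻¹ ^ 6 * y₂ (w x)) - 6 * γ * D ^ 2 * ((v x)⁻¹ ^ 5 * y₁ (w x))
        + 6 * γ ^ 2 * D * ((v x)⁻¹ ^ 4 * y (w x)) - 12 * γ ^ 3 * (v x)⁻¹ ^ 3) x) x := fun x hx =>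
    ((((d hy₂ 4 x hx).const_mul (D ^ 2)).sub ((d hy₁ 3 x hx).const_mul (2 * γ * D))).add
      ((d' 2 x hx).const_mul (6 * γ ^ 2))).congr_deriv (by push_cast; ring)
  have h₂ : ∀ x ∈ V, HasDerivAt (fun x => D ^ 3 * ((v x)⁻¹ ^ 6 * y₂ (w x))
        - 6 * γ * D ^ 2 * ((v x)⁻¹ ^ 5 * y₁ (w x))
        + 6 * γ ^ 2 * D * ((v x)⁻¹ ^ 4 * y (w x)) - 12 * γ ^ 3 * (v x)⁻¹ ^ 3)
      ((fun x => D ^ 4 * ((v x)⁻¹ ^ 8 * y₃ (w x)) - 12 * γ * D ^ 3 * ((v x)⁻¹ ^ 7 * y₂ (w x))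
        + 36 * γ ^ 2 * D ^ 2 * ((v x)⁻¹ ^ 6 * y₁ (w x))
        - 24 * γ ^ 3 * D * ((v x)⁻¹ ^ 5 * y (w x)) + 36 * γ ^ 4 * (v x)⁻¹ ^ 4) x) x := fun x hx =>
    (((((d hy₃ 6 x hx).const_mul (D ^ 3)).sub ((d hy₂ 5 x hx).const_mul (6 * γ * D ^ 2))).add
      ((d hy₁ 4 x hx).const_mul (6 * γ ^ 2 * D))).sub
        ((d' 3 x hx).const_mul (12 * γ ^ 3))).congr_deriv (by push_cast; ring)
  rw [solvesOn_iff_of_hasDerivAt hVo h₀ h₁ h₂]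
  intro x hx
  linear_combination D ^ 4 * (v x)⁻¹ ^ 8 * hE _ hx.2

theorem analyticAt_slAction {M : Matrix (Fin 2) (Fin 2) ℂ} {y : ℂ → ℂ} {x : ℂ}
    (hx : M 1 0 * x + M 1 1 ≠ 0)
    (hy : AnalyticAt ℂ y ((M 0 0 * x + M 0 1) / (M 1 0 * x + M 1 1))) :
    AnalyticAt ℂ (slAction M y) x := by
  have hv : AnalyticAt ℂ (fun x => M 1 0 * x + M 1 1) x := by fun_prop
  have hw : AnalyticAt ℂ (fun x => (M 0 0 * x + M 0 1) / (M 1 0 * x + M 1 1)) x :=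
    AnalyticAt.fun_div (by fun_prop) hv hx
  exact ((analyticAt_const.div (hv.pow 2) (pow_ne_zero 2 hx)).mul (hy.fun_comp_of_eq hw rfl)).sub
    (analyticAt_const.div hv hx)

/-! ### An explicit family of perturbations of -6/x -/

/-- The matrix of `x ↦ x₀ - ε / x`. -/
def pencil (x₀ ε : ℂ) : Matrix (Fin 2) (Fin 2) ℂ := !![x₀, -ε; 1, 0]

theorem slAction_pencil (x₀ ε : ℂ) (y : ℂ → ℂ) (x : ℂ) :
    slAction (pencil x₀ ε) y x = ε / x ^ 2 * y ((x₀ * x - ε) / x) - 6 / x := by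
  simp [slAction, pencil, Matrix.det_fin_two, sub_eq_add_neg]

theorem analyticAt_slAction_pencil {x₀ x : ℂ} {y : ℂ → ℂ} (hy : AnalyticAt ℂ y x₀) (hx : x ≠ 0) :
    AnalyticAt ℂ (fun p : ℂ × ℂ => slAction (pencil x₀ p.2) y p.1) (x, 0) := by
  simp only [slAction_pencil]
  have h₁ : AnalyticAt ℂ (fun p : ℂ × ℂ => (x₀ * p.1 - p.2) / p.1) (x, 0) :=
    ((analyticAt_const.mul analyticAt_fst).sub analyticAt_snd).fun_div analyticAt_fst hx
  have h₂ : AnalyticAt ℂ y ((fun p : ℂ × ℂ => (x₀ * p.1 - p.2) / p.1) (x, 0)) := by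
    have : (x₀ * x - 0) / x = x₀ := by field_simp; ring
    simpa only [this] using hy
  exact ((analyticAt_snd.fun_div (analyticAt_fst.fun_pow 2) (pow_ne_zero 2 hx)).mul
    (h₂.fun_comp_of_eq h₁ rfl)).sub (analyticAt_const.fun_div analyticAt_fst hx)

theorem tendstoLocallyUniformlyOn_slAction_pencil {x₀ : ℂ} {y : ℂ → ℂ} (hy : AnalyticAt ℂ y x₀) :
    TendstoLocallyUniformlyOn (fun ε => slAction (pencil x₀ ε) y) (fun x => -6 / x)
      (𝓝[≠] (0 : ℂ)) {x | x ≠ 0} := by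
  rw [Metric.tendstoLocallyUniformlyOn_iff]
  intro η hη x hx
  have hx' : x ≠ 0 := hx
  have h₁ := (analyticAt_slAction_pencil hy hx').continuousAt
  have h₂ : ContinuousAt (fun p : ℂ × ℂ => -6 / p.1) (x, 0) :=
    continuousAt_const.div continuousAt_fst hx'
  have h₃ := h₂.dist h₁
  have h₄ : dist (-6 / ((x, 0) : ℂ × ℂ).1)
      (slAction (pencil x₀ ((x, 0) : ℂ × ℂ).2) y ((x, 0) : ℂ × ℂ).1) < η := by
    simp [slAction_pencil, neg_div, hη]
  have h₅ := h₃.eventually_lt continuousAt_const h₄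
  rw [nhds_prod_eq, eventually_prod_iff] at h₅
  obtain ⟨pa, ha, pb, hb, hab⟩ := h₅
  exact ⟨{z | pa z}, mem_nhdsWithin_of_mem_nhds ha,
    (hb.filter_mono nhdsWithin_le_nhds).mono fun ε hε z hz => hab hz hε⟩

/-- If y is analytic within ρ of x₀, then |x| ≥ r and |ε| < ρr keep x₀ - ε/x in that disc, so no
pole lies there. -/
theorem allPolesCluster_slAction_pencil {x₀ : ℂ} {y : ℂ → ℂ} (hy : AnalyticAt ℂ y x₀) :
    AllPolesCluster fun ε => slAction (pencil x₀ ε) y := by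
  intro r hr
  obtain ⟨ρ, hρ, hball⟩ := Metric.eventually_nhds_iff_ball.mp hy.eventually_analyticAt
  have hb : Metric.ball (0 : ℂ) (ρ * r) ∈ 𝓝[≠] (0 : ℂ) :=
    mem_nhdsWithin_of_mem_nhds (Metric.ball_mem_nhds _ (by positivity))
  filter_upwards [hb] with ε hε x hx
  rw [mem_ball_zero_iff] at hε ⊢
  by_contra! hxr
  have hx₀ : x ≠ 0 := norm_pos_iff.mp (hr.trans_le hxr)
  refine absurd hx (not_lt.mpr (AnalyticAt.meromorphicOrderAt_nonneg (analyticAt_slAction ?_ ?_)))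
  · simpa [pencil] using hx₀
  · refine hball _ ?_
    have : (pencil x₀ ε 0 0 * x + pencil x₀ ε 0 1) / (pencil x₀ ε 1 0 * x + pencil x₀ ε 1 1) - x₀
        = -(ε / x) := by
      simp [pencil]
      field_simp
      ring
    rw [mem_ball_iff_norm, this, norm_neg, norm_div, div_lt_iff₀ (norm_pos_iff.mpr hx₀)]
    exact hε.trans_le (by gcongr)

theorem slAction_pencil_not_eventuallyEq {k : ℝ} (hk_six : k ≠ 6) {u : ℂ[X]} (hu : u ≠ 0)
    (hu' : derivative u ≠ 0) (x₀ : ℂ) {ε : ℂ} (hε : ε ≠ 0) :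
    ¬ (slAction (pencil x₀ ε) (coleHopf k u) =ᶠ[𝓝[≠] (0 : ℂ)] fun x => -6 / x) := by
  intro h
  -- Equality with -6/x would force `coleHopf` to take the value 0 at x₀ - ε/x. This happens at
  -- zeros of u' and, since division by zero gives 0, at zeros of u. Only finitely many x qualify.
  have hfin : ((fun z => ε / (x₀ - z)) '' {z | (u * derivative u).IsRoot z}).Finite :=
    (finite_setOfPred_isRoot (mul_ne_zero hu hu')).image _
  have hcof := nhdsNE_le_cofinite (a := (0 : ℂ)) hfin.compl_mem_cofinite
  obtain ⟨x, ⟨hx, hxc⟩, hx₀⟩ := ((h.and hcof).and self_mem_nhdsWithin).exists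
  have hx₀ : x ≠ 0 := hx₀
  apply hxc
  refine ⟨(x₀ * x - ε) / x, ?_, ?_⟩
  · simp only [slAction_pencil, neg_div] at hx
    rw [sub_eq_neg_self, mul_eq_zero, or_iff_right (by positivity),
      coleHopf, mul_eq_zero, or_iff_right, div_eq_zero_iff] at hx
    · simp only [Set.mem_ofPred_eq, IsRoot.def, eval_mul, mul_eq_zero]
      exact hx.symm
    · have : (k : ℂ) - 6 ≠ 0 := by
        rw [sub_ne_zero]
        exact_mod_cast hk_six
      exact div_ne_zero this two_ne_zero
  · have : x₀ - (x₀ * x - ε) / x = ε / x := by field_simp; ring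
    simp only [this]
    field_simp

theorem exists_perturbation_family {k : ℝ} (hk_six : k ≠ 6) {u : ℂ[X]} (hu : u ≠ 0)
    (hu' : derivative u ≠ 0) :
    ∃ M : ℂ → Matrix (Fin 2) (Fin 2) ℂ, (∀ i j, AnalyticAt ℂ (fun ε => M ε i j) 0) ∧
      (∀ᶠ ε in 𝓝[≠] (0 : ℂ), (M ε).det ≠ 0) ∧
      IsPerturbationFamily (fun ε => slAction (M ε) (coleHopf k u)) ∧
      AllPolesCluster (fun ε => slAction (M ε) (coleHopf k u)) := by
  obtain ⟨x₀, hx₀⟩ : ∃ x₀, u.eval x₀ ≠ 0 := by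
    by_contra! h
    exact hu (Polynomial.funext fun x => by rw [h x, eval_zero])
  have hy := analyticAt_coleHopf k hx₀
  refine ⟨pencil x₀, ?_, ?_, ⟨fun x hx => analyticAt_slAction_pencil hy hx, fun x _ => ?_,
    tendstoLocallyUniformlyOn_slAction_pencil hy, ?_⟩, allPolesCluster_slAction_pencil hy⟩
  · intro i j
    fin_cases i <;> fin_cases j <;> simp [pencil] <;> fun_prop
  · filter_upwards [self_mem_nhdsWithin] with ε hε
    simpa [pencil, Matrix.det_fin_two] using hε
  · simp [slAction_pencil, neg_div]
  · filter_upwards [self_mem_nhdsWithin] with ε hε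
    exact slAction_pencil_not_eventuallyEq hk_six hu hu' x₀ hε

/-! ### Two colliding poles: the cross-ratio argument -/

theorem mem_poles_slAction {M : Matrix (Fin 2) (Fin 2) ℂ} {k : ℝ} {u : ℂ[X]} {x : ℂ}
    (hx : x ∈ poles (slAction M (coleHopf k u))) :
    M 1 0 * x + M 1 1 = 0 ∨ u.eval ((M 0 0 * x + M 0 1) / (M 1 0 * x + M 1 1)) = 0 := by
  by_contra! h
  exact absurd hx (not_lt.mpr
    (analyticAt_slAction h.1 (analyticAt_coleHopf k h.2)).meromorphicOrderAt_nonneg)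

section CrossRatio

/-- The determinant of two vectors in the plane. -/
def bracket (p q : ℂ × ℂ) : ℂ := p.1 * q.2 - q.1 * p.2

/-- Homogeneous coordinates of the roots of `u` and of the point at infinity. -/
def projRoots (u : ℂ[X]) : Finset (ℂ × ℂ) :=
  insert (1, 0) (u.roots.toFinset.image fun z => (z, 1))

/-- Infinity is always admitted as a possible image of a pole, whether or not a pole really occurs
there. A finite set containing all images suffices. -/
theorem exists_projRoots_of_mem_poles {M : Matrix (Fin 2) (Fin 2) ℂ} {k : ℝ} {u : ℂ[X]}
    (hu : u ≠ 0) {x : ℂ} (hx : x ∈ poles (slAction M (coleHopf k u))) :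
    ∃ p ∈ projRoots u, ∃ l : ℂ, M 0 0 * x + M 0 1 = l * p.1 ∧ M 1 0 * x + M 1 1 = l * p.2 := by
  by_cases hv : M 1 0 * x + M 1 1 = 0
  · exact ⟨(1, 0), by simp [projRoots], M 0 0 * x + M 0 1, by simp, by simp [hv]⟩
  · have h := (mem_poles_slAction hx).resolve_left hv
    refine ⟨((M 0 0 * x + M 0 1) / (M 1 0 * x + M 1 1), 1), ?_, M 1 0 * x + M 1 1, ?_, by simp⟩
    · simp only [projRoots, Finset.mem_insert, Finset.mem_image, Multiset.mem_toFinset]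
      exact Or.inr ⟨_, (mem_roots hu).mpr h, rfl⟩
    · exact (mul_div_cancel₀ _ hv).symm

theorem det_mul_sub_eq_bracket {M : Matrix (Fin 2) (Fin 2) ℂ} {x y l m : ℂ} {p q : ℂ × ℂ}
    (hx₀ : M 0 0 * x + M 0 1 = l * p.1) (hx₁ : M 1 0 * x + M 1 1 = l * p.2)
    (hy₀ : M 0 0 * y + M 0 1 = m * q.1) (hy₁ : M 1 0 * y + M 1 1 = m * q.2) :
    M.det * (x - y) = l * m * bracket p q := by
  rw [Matrix.det_fin_two, bracket]
  linear_combination (M 1 0 * y + M 1 1) * hx₀ + l * p.1 * hy₁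
    - (M 1 0 * x + M 1 1) * hy₀ - m * q.1 * hx₁

theorem exists_bracket_bound (R : Finset (ℂ × ℂ)) :
    ∃ K : ℝ, 1 ≤ K ∧ ∀ a ∈ R, ∀ b ∈ R, ∀ c ∈ R, ∀ d ∈ R, bracket a b * bracket c d ≠ 0 →
      ‖bracket a c * bracket b d‖ ≤ K * ‖bracket a b * bracket c d‖ := by
  set f : (ℂ × ℂ) × (ℂ × ℂ) × (ℂ × ℂ) × (ℂ × ℂ) → ℝ := fun t =>
    ‖bracket t.1 t.2.2.1 * bracket t.2.1 t.2.2.2‖ / ‖bracket t.1 t.2.1 * bracket t.2.2.1 t.2.2.2‖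
    with hf
  have hf₀ : ∀ t, 0 ≤ f t := fun t => by positivity
  refine ⟨1 + ∑ t ∈ R ×ˢ R ×ˢ R ×ˢ R, f t, le_add_of_nonneg_right
    (Finset.sum_nonneg fun t _ => hf₀ t), fun a ha b hb c hc d hd h => ?_⟩
  have hmem : (a, b, c, d) ∈ R ×ˢ R ×ˢ R ×ˢ R := by simp [ha, hb, hc, hd]
  have h₁ := Finset.single_le_sum (f := f) (fun t _ => hf₀ t) hmem
  rw [← div_le_iff₀ (norm_pos_iff.mpr h)]
  change f (a, b, c, d) ≤ _
  linarith

/-- Cross-ratios are Möbius invariant. Those of the poles are cross-ratios of points of the finite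
set `projRoots u`, hence bounded by a constant independent of M. -/
theorem dist_bound_of_poles {u : ℂ[X]} (hu : u ≠ 0) :
    ∃ K : ℝ, 1 ≤ K ∧ ∀ (k : ℝ) (M : Matrix (Fin 2) (Fin 2) ℂ), M.det ≠ 0 → ∀ s t p q : ℂ,
      s ∈ poles (slAction M (coleHopf k u)) → t ∈ poles (slAction M (coleHopf k u)) →
      p ∈ poles (slAction M (coleHopf k u)) → q ∈ poles (slAction M (coleHopf k u)) →
      s ≠ t → p ≠ q → ‖s - p‖ * ‖t - q‖ ≤ K * (‖s - t‖ * ‖p - q‖) := by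
  obtain ⟨K, hK₁, hK⟩ := exists_bracket_bound (projRoots u)
  refine ⟨K, hK₁, fun k M hM s t p q hs ht hp hq hst hpq => ?_⟩
  obtain ⟨a, ha, l₁, ha₀, ha₁⟩ := exists_projRoots_of_mem_poles hu hs
  obtain ⟨b, hb, l₂, hb₀, hb₁⟩ := exists_projRoots_of_mem_poles hu ht
  obtain ⟨c, hc, l₃, hc₀, hc₁⟩ := exists_projRoots_of_mem_poles hu hp
  obtain ⟨d, hd, l₄, hd₀, hd₁⟩ := exists_projRoots_of_mem_poles hu hq
  have e₁ := det_mul_sub_eq_bracket ha₀ ha₁ hb₀ hb₁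
  have e₂ := det_mul_sub_eq_bracket hc₀ hc₁ hd₀ hd₁
  have e₃ := det_mul_sub_eq_bracket ha₀ ha₁ hc₀ hc₁
  have e₄ := det_mul_sub_eq_bracket hb₀ hb₁ hd₀ hd₁
  have hne : bracket a b * bracket c d ≠ 0 := by
    have h₁ : l₁ * l₂ * bracket a b ≠ 0 := e₁ ▸ mul_ne_zero hM (sub_ne_zero.mpr hst)
    have h₂ : l₃ * l₄ * bracket c d ≠ 0 := e₂ ▸ mul_ne_zero hM (sub_ne_zero.mpr hpq)
    exact mul_ne_zero (right_ne_zero_of_mul h₁) (right_ne_zero_of_mul h₂)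
  have hcross : (s - p) * (t - q) * (bracket a b * bracket c d) =
      (s - t) * (p - q) * (bracket a c * bracket b d) := by
    rw [← mul_right_inj' (pow_ne_zero 2 hM)]
    linear_combination (bracket a b * bracket c d) * (M.det * (t - q) * e₃
        + l₁ * l₃ * bracket a c * e₄)
      - (bracket a c * bracket b d) * (M.det * (p - q) * e₁ + l₁ * l₂ * bracket a b * e₂)
  have hpos : 0 < ‖bracket a b * bracket c d‖ := norm_pos_iff.mpr hne
  rw [← mul_le_mul_iff_left₀ hpos, ← norm_mul, ← norm_mul, hcross, norm_mul, norm_mul (s - t)]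
  calc _ ≤ ‖s - t‖ * ‖p - q‖ * (K * ‖bracket a b * bracket c d‖) := by
        gcongr
        exact hK a ha b hb c hc d hd hne
    _ = _ := by ring

theorem allPolesButOneCluster_of_two {k : ℝ} {u : ℂ[X]} (hu : u ≠ 0)
    {M : ℂ → Matrix (Fin 2) (Fin 2) ℂ} (hM : ∀ᶠ ε in 𝓝[≠] (0 : ℂ), (M ε).det ≠ 0)
    (h : TwoPolesCluster fun ε => slAction (M ε) (coleHopf k u)) :
    AllPolesButOneCluster fun ε => slAction (M ε) (coleHopf k u) := by
  obtain ⟨K, hK₁, hK⟩ := dist_bound_of_poles hu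
  intro r hr
  -- With s, t within ρ of 0 and p, q outside radius r, the estimates below give r|p-q| ≤ 8AB and
  -- |s-t| ≤ 2ρ. The cross-ratio bound then yields r ≤ 16Kρ, while ρ(16K+2) = r.
  set ρ := r / (16 * K + 2) with hρ
  have hρ₀ : 0 < ρ := by positivity
  have hρr : ρ * (16 * K + 2) = r := by rw [hρ]; field_simp
  filter_upwards [hM, h ρ hρ₀] with ε hε h2
  by_contra hlt
  rw [not_le, Set.one_lt_encard_iff] at hlt
  obtain ⟨p, q, hp, hq, hpq⟩ := hlt
  have h1 : 1 < (poles (slAction (M ε) (coleHopf k u)) ∩ Metric.ball 0 ρ).encard :=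
    lt_of_lt_of_le (by norm_num) h2
  rw [Set.one_lt_encard_iff] at h1
  obtain ⟨s, t, hs, ht, hst⟩ := h1
  have hb := hK k (M ε) hε s t p q hs.1 ht.1 hp.1 hq.1 hst hpq
  have hs' := mem_ball_zero_iff.mp hs.2
  have ht' := mem_ball_zero_iff.mp ht.2
  have hp' : r ≤ ‖p‖ := by simpa using hp.2
  have hq' : r ≤ ‖q‖ := by simpa using hq.2
  have i₁ : ‖p‖ ≤ ‖s‖ + ‖s - p‖ := by
    have := norm_sub_le s (s - p); simpa using this
  have i₂ : ‖q‖ ≤ ‖t‖ + ‖t - q‖ := by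
    have := norm_sub_le t (t - q); simpa using this
  have i₃ : ‖s - t‖ ≤ 2 * ρ := (norm_sub_le s t).trans (by linarith)
  have i₄ : ‖p - q‖ ≤ ‖s - p‖ + ‖t - q‖ + ‖s - t‖ := by
    have : p - q = (s - t) - (s - p) + (t - q) := by ring
    rw [this]
    have a₁ := norm_add_le ((s - t) - (s - p)) (t - q)
    have a₂ := norm_sub_le (s - t) (s - p)
    linarith
  have hρ' : 18 * ρ ≤ r := by nlinarith
  set A := ‖s - p‖
  set B := ‖t - q‖
  have hA : r / 2 ≤ A := by linarith
  have hB : r / 2 ≤ B := by linarith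
  have hAB₀ : 0 < A * B := mul_pos (by linarith) (by linarith)
  have j₁ : r * (‖p - q‖) ≤ 8 * (A * B) := by
    have : ‖p - q‖ ≤ 3 * A + B := by linarith
    have k₁ : r * A ≤ 2 * B * A := mul_le_mul_of_nonneg_right (by linarith) (by linarith)
    have k₂ : r * B ≤ 2 * A * B := mul_le_mul_of_nonneg_right (by linarith) (by linarith)
    nlinarith
  have j₂ : r * (A * B) ≤ K * (2 * ρ) * (8 * (A * B)) := by
    calc r * (A * B) ≤ r * (K * (‖s - t‖ * ‖p - q‖)) := by gcongr
      _ = K * ‖s - t‖ * (r * ‖p - q‖) := by ring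
      _ ≤ _ := by gcongr
  have j₃ : r * (A * B) ≤ (16 * K * ρ) * (A * B) := by linarith
  have j₄ := le_of_mul_le_mul_right j₃ hAB₀
  linarith

end CrossRatio

/-! ### Convergence to -6/x: limits of polynomials of degree at most d -/

/-- The polynomial `(γ x + δ)^d u((α x + β)/(γ x + δ))`. -/
def homTransform (d : ℕ) (u : ℂ[X]) (M : Matrix (Fin 2) (Fin 2) ℂ) : ℂ[X] :=
  ∑ i ∈ Finset.range (d + 1), C (u.coeff i) * ((C (M 0 0) * X + C (M 0 1)) ^ i *
    (C (M 1 0) * X + C (M 1 1)) ^ (d - i))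

theorem natDegree_homTransform_le (d : ℕ) (u : ℂ[X]) (M : Matrix (Fin 2) (Fin 2) ℂ) :
    (homTransform d u M).natDegree ≤ d := by
  refine natDegree_sum_le_of_forall_le _ _ fun i hi => ?_
  have hi' : i ≤ d := Nat.lt_succ_iff.mp (Finset.mem_range.mp hi)
  have hl : ∀ a b : ℂ, (C a * X + C b).natDegree ≤ 1 := fun a b => natDegree_linear_le
  refine (natDegree_C_mul_le _ _).trans (natDegree_mul_le.trans ?_)
  have h₁ := natDegree_pow_le_of_le i (hl (M 0 0) (M 0 1))
  have h₂ := natDegree_pow_le_of_le (d - i) (hl (M 1 0) (M 1 1))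
  omega

theorem eval_homTransform {d : ℕ} {u : ℂ[X]} (hd : u.natDegree ≤ d)
    {M : Matrix (Fin 2) (Fin 2) ℂ} {x : ℂ} (hx : M 1 0 * x + M 1 1 ≠ 0) :
    (homTransform d u M).eval x = (M 1 0 * x + M 1 1) ^ d *
      u.eval ((M 0 0 * x + M 0 1) / (M 1 0 * x + M 1 1)) := by
  rw [homTransform, eval_finsetSum, eval_eq_sum_range' (Nat.lt_succ_of_le hd), Finset.mul_sum]
  refine Finset.sum_congr rfl fun i hi => ?_
  have hi' : i ≤ d := Nat.lt_succ_iff.mp (Finset.mem_range.mp hi)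
  simp only [eval_mul, eval_C, eval_pow, eval_add, eval_X]
  rw [div_pow, pow_sub₀ _ hx hi']
  field_simp

theorem homTransform_ne_zero {d : ℕ} {u : ℂ[X]} (hu : u ≠ 0) (hd : u.natDegree ≤ d)
    {M : Matrix (Fin 2) (Fin 2) ℂ} (hM : M.det ≠ 0) : homTransform d u M ≠ 0 := by
  rw [Matrix.det_fin_two] at hM
  have hl : C (M 0 0) - C (M 1 0) * X ≠ 0 := by
    intro h
    have h₀ := congrArg (eval 0) h
    have h₁ := congrArg (eval 1) h
    simp at h₀ h₁
    rw [h₀] at h₁ hM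
    apply hM
    simp [neg_eq_zero.mp (by simpa using h₁ : -M 1 0 = 0)]
  obtain ⟨z, hz⟩ : ∃ z, (u * (C (M 0 0) - C (M 1 0) * X)).eval z ≠ 0 := by
    by_contra! h
    exact mul_ne_zero hu hl (Polynomial.funext fun x => by rw [h x, eval_zero])
  simp only [eval_mul, eval_sub, eval_C, eval_X] at hz
  have hz₁ := left_ne_zero_of_mul hz
  have hz₂ := right_ne_zero_of_mul hz
  -- The preimage under M of a point z with u(z) ≠ 0 that is not the image of infinity.
  set x := (M 1 1 * z - M 0 1) / (M 0 0 - M 1 0 * z) with hx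
  have hv : M 1 0 * x + M 1 1 = (M 0 0 * M 1 1 - M 0 1 * M 1 0) / (M 0 0 - M 1 0 * z) := by
    rw [hx]; field_simp; ring
  have hn : M 0 0 * x + M 0 1 = z * ((M 0 0 * M 1 1 - M 0 1 * M 1 0) / (M 0 0 - M 1 0 * z)) := by
    rw [hx, mul_div_assoc', mul_div_assoc', div_add' _ _ _ hz₂]
    congr 1
    ring
  have hv₀ : M 1 0 * x + M 1 1 ≠ 0 := by rw [hv]; exact div_ne_zero hM hz₂
  intro h
  have he := eval_homTransform hd hv₀
  rw [h, eval_zero, hn, ← hv, mul_div_cancel_right₀ _ hv₀] at he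
  exact mul_ne_zero (pow_ne_zero d hv₀) hz₁ he.symm

/-- In the logarithmic derivative of (γx+δ)^d u(Mx) the first factor contributes dγ/(γx+δ).
Multiplied by c it is the shift -6γ/(γx+δ), because dc = -6. -/
theorem slAction_eq_log_deriv {k : ℝ} {d : ℕ} {u : ℂ[X]} (hd : u.natDegree ≤ d)
    (hdk : (d : ℂ) * (((k : ℂ) - 6) / 2) = -6) {M : Matrix (Fin 2) (Fin 2) ℂ} {x : ℂ}
    (hx : M 1 0 * x + M 1 1 ≠ 0) (hψ : (homTransform d u M).eval x ≠ 0) :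
    slAction M (coleHopf k u) x = ((k : ℂ) - 6) / 2 *
      ((derivative (homTransform d u M)).eval x / (homTransform d u M).eval x) := by
  have hvd : HasDerivAt (fun z => M 1 0 * z + M 1 1) (M 1 0) x := by
    simpa using ((hasDerivAt_id x).const_mul (M 1 0)).add_const (M 1 1)
  have hwd : HasDerivAt (fun z => M 0 0 * z + M 0 1) (M 0 0) x := by
    simpa using ((hasDerivAt_id x).const_mul (M 0 0)).add_const (M 0 1)
  have h₁ := (hvd.fun_pow d).mul ((u.hasDerivAt _).comp x (hwd.fun_div hvd hx))
  have h₂ := (homTransform d u M).hasDerivAt x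
  have heq : (fun z => (M 1 0 * z + M 1 1) ^ d) *
      ((fun x => u.eval x) ∘ fun z => (M 0 0 * z + M 0 1) / (M 1 0 * z + M 1 1)) =ᶠ[𝓝 x]
      fun z => (homTransform d u M).eval z := by
    filter_upwards [hvd.continuousAt.eventually_ne hx] with z hz
    rw [eval_homTransform hd hz]
    rfl
  have h₃ := (h₁.congr_of_eventuallyEq heq.symm).unique h₂
  rw [eval_homTransform hd hx] at hψ ⊢
  have hu := right_ne_zero_of_mul hψ
  rw [← h₃, slAction, coleHopf, Matrix.det_fin_two]
  simp only [Function.comp]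
  generalize ((k : ℂ) - 6) / 2 = c at hdk ⊢
  have h6 : (6 : ℂ) = -(d * c) := by linear_combination hdk
  have e1 : M 0 0 * (M 1 0 * x + M 1 1) - (M 0 0 * x + M 0 1) * M 1 0 =
    M 0 0 * M 1 1 - M 0 1 * M 1 0 := by ring
  rw [h6, e1]
  generalize (M 0 0 * x + M 0 1) / (M 1 0 * x + M 1 1) = w at *
  generalize M 1 0 * x + M 1 1 = v at *
  rcases d with _ | d
  · simp at hdk
  · rw [Nat.add_sub_cancel]
    field_simp
    ring

theorem linear_ne_zero_of_det {M : Matrix (Fin 2) (Fin 2) ℂ} (hM : M.det ≠ 0) :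
    C (M 1 0) * X + C (M 1 1) ≠ 0 := by
  intro h
  have h₀ := congrArg (eval 0) h
  have h₁ := congrArg (eval 1) h
  simp at h₀ h₁
  rw [h₀, add_zero] at h₁
  exact hM (by rw [Matrix.det_fin_two, h₀, h₁]; ring)

/-- The order at x depends only on a punctured neighbourhood, where the logarithmic-derivative
formula holds off a finite set. So the point over infinity needs no separate treatment. -/
theorem eval_homTransform_of_mem_poles {k : ℝ} {d : ℕ} {u : ℂ[X]} (hu : u ≠ 0)
    (hd : u.natDegree ≤ d) (hdk : (d : ℂ) * (((k : ℂ) - 6) / 2) = -6)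
    {M : Matrix (Fin 2) (Fin 2) ℂ} (hM : M.det ≠ 0) {x : ℂ}
    (hx : x ∈ poles (slAction M (coleHopf k u))) : (homTransform d u M).eval x = 0 := by
  by_contra hψ
  have hcof := nhdsNE_le_cofinite (a := x) (finite_setOfPred_isRoot
    (mul_ne_zero (linear_ne_zero_of_det hM) (homTransform_ne_zero hu hd hM))).compl_mem_cofinite
  have heq : slAction M (coleHopf k u) =ᶠ[𝓝[≠] x] fun x => ((k : ℂ) - 6) / 2 *
      ((derivative (homTransform d u M)).eval x / (homTransform d u M).eval x) := by
    filter_upwards [hcof] with z hz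
    have hz' : (M 1 0 * z + M 1 1) * (homTransform d u M).eval z ≠ 0 := by
      intro h
      exact hz (by simpa [IsRoot.def] using h)
    exact slAction_eq_log_deriv hd hdk (left_ne_zero_of_mul hz') (right_ne_zero_of_mul hz')
  refine absurd hx (not_lt.mpr ?_ : ¬ meromorphicOrderAt _ x < 0)
  rw [meromorphicOrderAt_congr heq]
  exact (analyticAt_coleHopf k hψ).meromorphicOrderAt_nonneg

/-- The coefficients of degree at most `d` of a polynomial. -/
def coeffVec (d : ℕ) (p : ℂ[X]) (i : Fin (d + 1)) : ℂ := p.coeff i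

theorem eval_eq_sum_coeffVec {d : ℕ} {p : ℂ[X]} (hp : p.natDegree ≤ d) (x : ℂ) :
    p.eval x = ∑ i, coeffVec d p i * x ^ (i : ℕ) := by
  rw [eval_eq_sum_range' (Nat.lt_succ_of_le hp)]
  exact (Fin.sum_univ_eq_sum_range (fun i => p.coeff i * x ^ i) (d + 1)).symm

theorem mul_eval_derivative_eq_sum_coeffVec {d : ℕ} {p : ℂ[X]} (hp : p.natDegree ≤ d) (x : ℂ) :
    x * (derivative p).eval x = ∑ i : Fin (d + 1), ((i : ℕ) : ℂ) * coeffVec d p i * x ^ (i : ℕ) := by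
  rw [derivative_eval, sum_over_range' _ (by simp) (d + 1) (Nat.lt_succ_of_le hp), Finset.mul_sum,
    ← Fin.sum_univ_eq_sum_range (fun i => x * (p.coeff i * i * x ^ (i - 1)))]
  refine Finset.sum_congr rfl fun i _ => ?_
  rw [coeffVec]
  rcases (i : ℕ) with _ | j
  · simp
  · rw [Nat.add_sub_cancel]; ring

theorem coeffVec_ne_zero {d : ℕ} {p : ℂ[X]} (hp : p.natDegree ≤ d) (h : p ≠ 0) :
    coeffVec d p ≠ 0 := fun h0 => h <| Polynomial.funext fun x => by
  rw [eval_eq_sum_coeffVec hp, h0]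
  simp

theorem eq_zero_of_infinite_sum_eq_zero {d : ℕ} {b : Fin (d + 1) → ℂ} {S : Set ℂ}
    (hS : S.Infinite) (h : ∀ x ∈ S, ∑ i, b i * x ^ (i : ℕ) = 0) (i : Fin (d + 1)) : b i = 0 := by
  set p : ℂ[X] := ∑ i, C (b i) * X ^ (i : ℕ) with hp
  have h0 : p = 0 := eq_zero_of_infinite_isRoot p <| hS.mono fun x hx => by
    have := h x hx
    simpa [hp, eval_finsetSum, IsRoot.def] using this
  have hc : p.coeff i = b i := by
    rw [hp, finsetSum_coeff]
    simp [coeff_X_pow, Fin.val_inj]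
  rw [← hc, h0, coeff_zero]

/-- For |x| ≥ r the lower terms are at most |x|^d times a quantity tending to 0, while the leading
coefficient stays away from 0. -/
theorem eventually_sum_ne_zero_of_tendsto {ι : Type*} {F : Filter ι} {d : ℕ}
    {v : ι → Fin (d + 1) → ℂ} {q : Fin (d + 1) → ℂ} (hv : Tendsto v F (𝓝 q))
    (hq : ∀ i : Fin (d + 1), (i : ℕ) ≠ d → q i = 0) (hqd : q (Fin.last d) ≠ 0) {r : ℝ}
    (hr : 0 < r) : ∀ᶠ j in F, ∀ x : ℂ, r ≤ ‖x‖ → ∑ i, v j i * x ^ (i : ℕ) ≠ 0 := by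
  have hvi : ∀ i, Tendsto (fun j => v j i) F (𝓝 (q i)) := tendsto_pi_nhds.mp hv
  have hlim : Tendsto (fun j => ∑ i : Fin d, ‖v j i.castSucc‖ * r⁻¹ ^ (d - (i : ℕ))) F (𝓝 0) := by
    have : Tendsto (fun j => ∑ i : Fin d, ‖v j i.castSucc‖ * r⁻¹ ^ (d - (i : ℕ))) F
        (𝓝 (∑ i : Fin d, ‖q i.castSucc‖ * r⁻¹ ^ (d - (i : ℕ)))) :=
      tendsto_finsetSum _ fun i _ => (hvi _).norm.mul_const _
    convert this using 2
    refine (Finset.sum_eq_zero fun i _ => ?_).symm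
    rw [hq i.castSucc (by simpa using i.2.ne), norm_zero, zero_mul]
  have hlt := hlim.eventually_lt (hvi (Fin.last d)).norm (norm_pos_iff.mpr hqd)
  filter_upwards [hlt] with j hj x hx h0
  have hx₀ : 0 < ‖x‖ := hr.trans_le hx
  rw [Fin.sum_univ_castSucc, add_comm, add_eq_zero_iff_eq_neg] at h0
  have h1 := congrArg norm h0
  rw [norm_neg, norm_mul, norm_pow, Fin.val_last] at h1
  have h2 : ‖∑ i : Fin d, v j i.castSucc * x ^ ((i.castSucc : Fin (d + 1)) : ℕ)‖ ≤
      (∑ i : Fin d, ‖v j i.castSucc‖ * r⁻¹ ^ (d - (i : ℕ))) * ‖x‖ ^ d := by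
    rw [Finset.sum_mul]
    refine (norm_sum_le _ _).trans (Finset.sum_le_sum fun i _ => ?_)
    rw [norm_mul, norm_pow, Fin.val_castSucc, mul_assoc]
    gcongr
    have hpow : ‖x‖ ^ d = ‖x‖ ^ (d - (i : ℕ)) * ‖x‖ ^ (i : ℕ) := by
      rw [← pow_add, Nat.sub_add_cancel i.2.le]
    rw [hpow, ← mul_assoc, ← mul_pow]
    refine le_mul_of_one_le_left (by positivity) (one_le_pow₀ ?_)
    rw [inv_mul_eq_div, one_le_div hr]
    exact hx
  rw [← h1] at h2
  exact absurd (le_of_mul_le_mul_right h2 (by positivity)) (not_le.mpr hj)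

/-- If the logarithmic derivatives of polynomials of degree at most `d` tend to `d / x` at
infinitely many points, then the zeros tend to the origin. -/
theorem eventually_eval_ne_zero_of_tendsto {ι : Type*} (F : Ultrafilter ι) {d : ℕ}
    {ψ : ι → ℂ[X]} (hψ : ∀ᶠ j in F, ψ j ≠ 0) (hψd : ∀ j, (ψ j).natDegree ≤ d) {S : Set ℂ}
    (hS : S.Infinite) (hS₀ : ∀ x ∈ S, ∀ᶠ j in F, (ψ j).eval x ≠ 0)
    (hlim : ∀ x ∈ S, Tendsto (fun j => x * ((derivative (ψ j)).eval x / (ψ j).eval x)) F (𝓝 d))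
    {r : ℝ} (hr : 0 < r) : ∀ᶠ j in F, ∀ x : ℂ, r ≤ ‖x‖ → (ψ j).eval x ≠ 0 := by
  set b : ι → Fin (d + 1) → ℂ := fun j => coeffVec d (ψ j) with hb
  set v : ι → Fin (d + 1) → ℂ := fun j => ((‖b j‖⁻¹ : ℝ) : ℂ) • b j with hv
  have hev : ∀ j x, ∑ i, v j i * x ^ (i : ℕ) = ((‖b j‖⁻¹ : ℝ) : ℂ) * (ψ j).eval x := fun j x => by
    rw [eval_eq_sum_coeffVec (hψd j), Finset.mul_sum]
    refine Finset.sum_congr rfl fun i _ => ?_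
    simp only [hv, hb, Pi.smul_apply, smul_eq_mul]
    ring
  have hev' : ∀ j x, ∑ i : Fin (d + 1), ((i : ℕ) : ℂ) * v j i * x ^ (i : ℕ) =
      ((‖b j‖⁻¹ : ℝ) : ℂ) * (x * (derivative (ψ j)).eval x) := fun j x => by
    rw [mul_eval_derivative_eq_sum_coeffVec (hψd j), Finset.mul_sum]
    refine Finset.sum_congr rfl fun i _ => ?_
    simp only [hv, hb, Pi.smul_apply, smul_eq_mul]
    ring
  have hnorm : ∀ᶠ j in F, v j ∈ Metric.sphere (0 : Fin (d + 1) → ℂ) 1 := by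
    filter_upwards [hψ] with j hj
    have : ‖b j‖ ≠ 0 := norm_ne_zero_iff.mpr (coeffVec_ne_zero (hψd j) hj)
    rw [mem_sphere_zero_iff_norm, hv, norm_smul, Complex.norm_real, norm_inv, norm_norm,
      inv_mul_cancel₀ this]
  -- Coefficient vectors scaled to norm 1 lie on a compact sphere, so they converge along the
  -- ultrafilter to a nonzero limit.
  obtain ⟨q, hq₁, hq⟩ := (isCompact_sphere (0 : Fin (d + 1) → ℂ) 1).ultrafilter_le_nhds
    (F.map v) (le_principal_iff.mpr hnorm)
  have hq : Tendsto v F (𝓝 q) := hq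
  have hqi : ∀ i, Tendsto (fun j => v j i) F (𝓝 (q i)) := tendsto_pi_nhds.mp hq
  -- The limit polynomial q satisfies xq' = dq at infinitely many points. So only its x^d
  -- coefficient survives.
  have hz : ∀ x ∈ S, ∑ i : Fin (d + 1), (((i : ℕ) : ℂ) - d) * q i * x ^ (i : ℕ) = 0 := by
    intro x hx
    have t₁ : Tendsto (fun j => ∑ i, v j i * x ^ (i : ℕ)) F (𝓝 (∑ i, q i * x ^ (i : ℕ))) :=
      tendsto_finsetSum _ fun i _ => (hqi i).mul_const _
    have t₂ : Tendsto (fun j => ∑ i : Fin (d + 1), ((i : ℕ) : ℂ) * v j i * x ^ (i : ℕ)) F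
        (𝓝 (∑ i : Fin (d + 1), ((i : ℕ) : ℂ) * q i * x ^ (i : ℕ))) :=
      tendsto_finsetSum _ fun i _ => ((hqi i).const_mul _).mul_const _
    have t₃ := (hlim x hx).mul t₁
    have heq : (fun j => ∑ i : Fin (d + 1), ((i : ℕ) : ℂ) * v j i * x ^ (i : ℕ)) =ᶠ[F]
        fun j => x * ((derivative (ψ j)).eval x / (ψ j).eval x) * ∑ i, v j i * x ^ (i : ℕ) := by
      filter_upwards [hS₀ x hx] with j hj
      rw [hev, hev']
      field_simp
    have := tendsto_nhds_unique (t₂.congr' heq) t₃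
    rw [Finset.mul_sum, ← sub_eq_zero, ← Finset.sum_sub_distrib] at this
    rw [← this]
    exact Finset.sum_congr rfl fun i _ => by ring
  have hq0 : ∀ i : Fin (d + 1), (i : ℕ) ≠ d → q i = 0 := fun i hi =>
    (mul_eq_zero.mp (eq_zero_of_infinite_sum_eq_zero hS hz i)).resolve_left
      (sub_ne_zero.mpr (by exact_mod_cast hi))
  have hqd : q (Fin.last d) ≠ 0 := by
    intro h
    have : q = 0 := by
      ext i
      by_cases hi : (i : ℕ) = d
      · rw [show i = Fin.last d from Fin.ext hi, h]; rfl
      · exact hq0 i hi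
    rw [this] at hq₁
    simp at hq₁
  filter_upwards [eventually_sum_ne_zero_of_tendsto hq hq0 hqd hr] with j hj x hx h0
  exact hj x hx (by rw [hev, h0, mul_zero])

/-- Along an ultrafilter, nonzero polynomials of bounded degree vanish eventually at only finitely
many points. -/
theorem finite_setOf_eventually_eval_eq_zero {ι : Type*} (F : Ultrafilter ι) {n : ℕ}
    {p : ι → ℂ[X]} (hp : ∀ᶠ j in F, p j ≠ 0) (hn : ∀ j, (p j).natDegree ≤ n) :
    {x : ℂ | ∀ᶠ j in F, (p j).eval x = 0}.Finite := by
  by_contra hinf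
  obtain ⟨t, ht, hcard⟩ := Set.Infinite.exists_subset_card_eq hinf (n + 1)
  have hall : ∀ᶠ j in F, ∀ x ∈ t, (p j).eval x = 0 :=
    (Filter.eventually_all_finset t).mpr fun x hx => ht hx
  obtain ⟨j, hj, hj₀⟩ := (hall.and hp).exists
  have hle : t.card ≤ (p j).natDegree := card_le_degree_of_subset_roots fun x hx =>
    (mem_roots hj₀).mpr (hj x hx)
  have := hn j
  omega

/-- If the poles did not cluster, some ultrafilter would concentrate on the bad ε. Along it the
transforms of u are nonzero at all but finitely many points of V, so their logarithmic derivatives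
tend to d/x there and their zeros must tend to 0. -/
theorem allPolesCluster_of_tendsto {k : ℝ} {d : ℕ} {u : ℂ[X]} (hu : u ≠ 0)
    (hd : u.natDegree ≤ d) (hdk : (d : ℂ) * (((k : ℂ) - 6) / 2) = -6)
    {M : ℂ → Matrix (Fin 2) (Fin 2) ℂ} (hM : ∀ᶠ ε in 𝓝[≠] (0 : ℂ), (M ε).det ≠ 0)
    {V : Set ℂ} (hV : V.Infinite) (hlim : ∀ x ∈ V,
      Tendsto (fun ε => slAction (M ε) (coleHopf k u) x) (𝓝[≠] (0 : ℂ)) (𝓝 (-6 / x))) :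
    AllPolesCluster fun ε => slAction (M ε) (coleHopf k u) := by
  intro r hr
  by_contra hcon
  rw [Filter.not_eventually, Filter.frequently_iff_neBot] at hcon
  obtain ⟨F, hF⟩ := Ultrafilter.exists_le _ (h := hcon)
  have hF₀ : (F : Filter ℂ) ≤ 𝓝[≠] 0 := hF.trans inf_le_left
  have hF₁ : ∀ᶠ ε in F, ¬ poles (slAction (M ε) (coleHopf k u)) ⊆ Metric.ball 0 r :=
    le_principal_iff.mp (hF.trans inf_le_right)
  have hMF : ∀ᶠ ε in F, (M ε).det ≠ 0 := hM.filter_mono hF₀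
  set ψ : ℂ → ℂ[X] := fun ε => homTransform d u (M ε) with hψ
  set l : ℂ → ℂ[X] := fun ε => C (M ε 1 0) * X + C (M ε 1 1) with hl
  have hψ₀ : ∀ᶠ ε in F, ψ ε ≠ 0 := hMF.mono fun ε h => homTransform_ne_zero hu hd h
  have hψd : ∀ ε, (ψ ε).natDegree ≤ d := fun ε => natDegree_homTransform_le d u _
  have hfin := finite_setOf_eventually_eval_eq_zero F (p := fun ε => l ε * ψ ε) (n := 1 + d)
    (hMF.mono fun ε h => mul_ne_zero (linear_ne_zero_of_det h) (homTransform_ne_zero hu hd h))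
    (fun ε => natDegree_mul_le_of_le natDegree_linear_le (hψd ε))
  set T := {x : ℂ | ∀ᶠ ε in F, (l ε * ψ ε).eval x = 0} with hT
  have hS : (V \ (T ∪ {0})).Infinite := hV.sdiff (hfin.union (Set.finite_singleton 0))
  have hgood : ∀ x ∈ V \ (T ∪ {0}), ∀ᶠ ε in F,
      M ε 1 0 * x + M ε 1 1 ≠ 0 ∧ (ψ ε).eval x ≠ 0 := by
    intro x hx
    have hxT : ¬ ∀ᶠ ε in F, (l ε * ψ ε).eval x = 0 := fun h => hx.2 (Or.inl h)
    rw [← Ultrafilter.eventually_not] at hxT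
    filter_upwards [hxT] with ε h
    rw [eval_mul] at h
    refine ⟨?_, right_ne_zero_of_mul h⟩
    have := left_ne_zero_of_mul h
    simpa [hl] using this
  have hc : ((k : ℂ) - 6) / 2 ≠ 0 := by
    intro h
    rw [h, mul_zero] at hdk
    norm_num at hdk
  have hlim' : ∀ x ∈ V \ (T ∪ {0}),
      Tendsto (fun ε => x * ((derivative (ψ ε)).eval x / (ψ ε).eval x)) F (𝓝 (d : ℂ)) := by
    intro x hx
    have hx₀ : x ≠ 0 := fun h => hx.2 (Or.inr h)
    have h₁ := ((hlim x hx.1).mono_left hF₀).const_mul (x * (((k : ℂ) - 6) / 2)⁻¹)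
    have h₂ : x * (((k : ℂ) - 6) / 2)⁻¹ * (-6 / x) = d := by
      rw [← hdk]
      generalize ((k : ℂ) - 6) / 2 = c at *
      field_simp
    rw [h₂] at h₁
    refine h₁.congr' ?_
    filter_upwards [hgood x hx] with ε h
    rw [slAction_eq_log_deriv hd hdk h.1 h.2]
    generalize ((k : ℂ) - 6) / 2 = c at *
    field_simp
    rfl
  obtain ⟨ε, hε, hε₁, hεM⟩ := ((eventually_eval_ne_zero_of_tendsto F hψ₀ hψd hS
    (fun x hx => (hgood x hx).mono fun _ h => h.2) hlim' hr).and (hF₁.and hMF)).exists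
  refine hε₁ fun x hx => ?_
  by_contra hxr
  exact hε x (by simpa using hxr) (eval_homTransform_of_mem_poles hu hd hdk hεM hx)

/-! ### Assembly -/

theorem AllPolesCluster.allPolesButOneCluster {f : ℂ → ℂ → ℂ} (h : AllPolesCluster f) :
    AllPolesButOneCluster f := fun r hr => (h r hr).mono fun ε hε => by
  rw [Set.sdiff_eq_empty.mpr hε]
  simp

theorem eval_derivative_X_mul_comp_X_pow {n : ℕ} (hn : n ≠ 0) (q : ℂ[X]) :
    (derivative (X * q.comp (X ^ n))).eval 0 = q.eval 0 := by
  simp [derivative_mul, eval_comp, hn]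

theorem eventually_eq_coleHopf {k : ℝ} {n : ℕ} (hkn : k = n) (hn : n ≠ 0) {q : ℂ[X]}
    (hq : q.eval 0 = 1) {h : ℂ → ℂ} (hh : profile (((k : ℂ) - 6) / 2) n q =ᶠ[𝓝 0] h) :
    ∀ᶠ x in 𝓝[≠] (0 : ℂ), x⁻¹ * h (x ^ (k : ℂ)) = coleHopf k (X * q.comp (X ^ n)) x := by
  have ht : Tendsto (fun x : ℂ => x ^ n) (𝓝 0) (𝓝 0) := by
    simpa [hn] using (continuous_pow n).tendsto (0 : ℂ)
  filter_upwards [self_mem_nhdsWithin,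
    (ht.eventually hh).filter_mono nhdsWithin_le_nhds,
    (eventually_eval_pow_ne_zero hn hq).filter_mono nhdsWithin_le_nhds] with x hx hxh hxq
  have e : x ^ (k : ℂ) = x ^ n := by rw [hkn, Complex.ofReal_natCast, Complex.cpow_natCast]
  rw [coleHopf_eq_profile k n q hx hxq, e, hxh]

theorem allPolesButOneCluster_slAction {k : ℝ} {d : ℕ} {u : ℂ[X]} (hu : u ≠ 0)
    (hd : u.natDegree ≤ d) (hdk : (d : ℂ) * (((k : ℂ) - 6) / 2) = -6)
    {M : ℂ → Matrix (Fin 2) (Fin 2) ℂ} (hM : ∀ᶠ ε in 𝓝[≠] (0 : ℂ), (M ε).det ≠ 0)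
    (h : TwoPolesCluster (fun ε => slAction (M ε) (coleHopf k u)) ∨
      ∃ V : Set ℂ, IsOpen V ∧ V.Nonempty ∧ TendstoLocallyUniformlyOn
        (fun ε => slAction (M ε) (coleHopf k u)) (fun x => -6 / x) (𝓝[≠] (0 : ℂ)) V) :
    AllPolesButOneCluster (fun ε => slAction (M ε) (coleHopf k u)) := by
  rcases h with h | ⟨V, hVo, ⟨x, hx⟩, hV⟩
  · exact allPolesButOneCluster_of_two hu hM h
  · exact (allPolesCluster_of_tendsto hu hd hdk hM (infinite_of_mem_nhds x (hVo.mem_nhds hx))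
      fun z hz => hV.tendsto_at hz).allPolesButOneCluster

end ClassXII

end

theorem theorem8 (k : ℝ) (hk_pos : 0 < k) (hk_six : k ≠ 6)
    (hk_inv : ∀ n : ℕ, k ≠ 1 / (n : ℝ)) (a : ℂ) :
    ∃ h : ℂ → ℂ,
      (AnalyticAt ℂ h 0 ∧ h 0 = ((k : ℂ) - 6) / 2 ∧ deriv h 0 = a ∧
        ClassXII.SolvesAllBranches k h) ∧
      (∀ h₁ : ℂ → ℂ, AnalyticAt ℂ h₁ 0 → h₁ 0 = ((k : ℂ) - 6) / 2 → deriv h₁ 0 = a →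
        ClassXII.SolvesPrincipalBranch k h₁ → h₁ =ᶠ[𝓝 0] h) ∧
      (k = 2 ∨ k = 3 ∨ k = 4 ∨ k = 5 →
        ∃ u : ℂ[X], u ≠ 0 ∧ ClassXII.SolvesColeHopf k u ∧
          (∀ᶠ x in 𝓝[≠] (0 : ℂ), x⁻¹ * h (x ^ (k : ℂ)) = ClassXII.coleHopf k u x) ∧
          ClassXII.SolvesOn k (ClassXII.coleHopf k u) {x | u.eval x ≠ 0} ∧
          (∀ M : Matrix (Fin 2) (Fin 2) ℂ, M.det ≠ 0 →
            ClassXII.SolvesOn k (ClassXII.slAction M (ClassXII.coleHopf k u))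
              {x | M 1 0 * x + M 1 1 ≠ 0 ∧
                u.eval ((M 0 0 * x + M 0 1) / (M 1 0 * x + M 1 1)) ≠ 0}) ∧
          (∃ M : ℂ → Matrix (Fin 2) (Fin 2) ℂ,
            (∀ i j, AnalyticAt ℂ (fun ε => M ε i j) 0) ∧
            (∀ᶠ ε in 𝓝[≠] (0 : ℂ), (M ε).det ≠ 0) ∧
            ClassXII.IsPerturbationFamily
              (fun ε => ClassXII.slAction (M ε) (ClassXII.coleHopf k u)) ∧
            ClassXII.AllPolesCluster
              (fun ε => ClassXII.slAction (M ε) (ClassXII.coleHopf k u))) ∧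
          (∀ M : ℂ → Matrix (Fin 2) (Fin 2) ℂ, (∀ᶠ ε in 𝓝[≠] (0 : ℂ), (M ε).det ≠ 0) →
            (ClassXII.TwoPolesCluster
                (fun ε => ClassXII.slAction (M ε) (ClassXII.coleHopf k u)) ∨
              ∃ V : Set ℂ, IsOpen V ∧ V.Nonempty ∧ TendstoLocallyUniformlyOn
                (fun ε => ClassXII.slAction (M ε) (ClassXII.coleHopf k u))
                (fun x => -6 / x) (𝓝[≠] (0 : ℂ)) V) →
            ClassXII.AllPolesButOneCluster
              (fun ε => ClassXII.slAction (M ε) (ClassXII.coleHopf k u)))) := by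
  obtain ⟨h, hh, huniq⟩ := ClassXII.exists_solvesAllBranches hk_pos hk_six hk_inv a
  refine ⟨h, hh, huniq, fun hk => ?_⟩
  have hk6 : (k : ℂ) - 6 ≠ 0 := sub_ne_zero.mpr (by exact_mod_cast hk_six)
  obtain ⟨n, d, q, hkn, hn, hdk, hq, hq', hd, hu⟩ :=
    -- The profile of c u'/u has derivative c k q'(0) at 0, so this value of q'(0) makes it equal to
    -- a.
    ClassXII.exists_polynomial_solvesColeHopf hk (a / (((k : ℂ) - 6) / 2 * k))
  have hn₀ : n ≠ 0 := by omega
  have hk₀ : (k : ℂ) ≠ 0 := by exact_mod_cast hk_pos.ne'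
  set u : ℂ[X] := X * q.comp (X ^ n) with hu_def
  have hu' : derivative u ≠ 0 := fun h0 => by
    have := ClassXII.eval_derivative_X_mul_comp_X_pow hn₀ q
    rw [← hu_def, h0, eval_zero, hq] at this
    exact zero_ne_one this
  have hu₀ : u ≠ 0 := fun h0 => hu' (by rw [h0, derivative_zero])
  -- The uniqueness half of (1) identifies the rational solution with h.
  have hmatch : ClassXII.profile (((k : ℂ) - 6) / 2) n q =ᶠ[𝓝 0] h := by
    refine huniq _ (ClassXII.analyticAt_profile _ n (by rw [hq]; exact one_ne_zero)) ?_ ?_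
      (ClassXII.solvesPrincipalBranch_profile hk_pos hk_six hkn hq hu)
    · simp [ClassXII.profile]
    · have hkn' : (n : ℂ) = k := by rw [hkn, Complex.ofReal_natCast]
      rw [ClassXII.deriv_profile_zero _ n hq, hq', hkn']
      field_simp
  have hS := ClassXII.solvesOn_coleHopf hk_pos hk_six hu
  exact ⟨u, hu₀, hu, ClassXII.eventually_eq_coleHopf hkn hn₀ hq hmatch, hS,
    fun M _ => hS.slAction, ClassXII.exists_perturbation_family hk_six hu₀ hu',
    fun M hM h => ClassXII.allPolesButOneCluster_slAction hu₀ hd hdk hM h⟩
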